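/- A represented space $\mathbf X$ is a set $X$ with a partial surjection $\delta_{\mathbf X}\colon\subseteq\mathbb N^{\mathbb N}\to X$; if $\delta_{\mathbf X}(p)=x$, then $p$ is called a name of $x$. Subspaces carry the restricted representation, and products, countable powers, function spaces, $\mathbb N$ and $[0,1]\subseteq\mathbb R$ their standard representations. The Sierpi\'nski space $\mathbb S=\{\top,\bot\}$ is represented by $\delta(0^\omega)=\bot$ and $\delta(p)=\top$ for $p\neq 0^\omega$. A partial multi-valued map between represented spaces is computable if some Type-2 machine transforms every name of every point $x$ of its domain into a name of some value of the map in $x$. A set $U\subseteq X$ is open if its characteristic function $\mathbf X\to\mathbb S$ is continuously realisable. A name of an open set is a name of its characteristic function in the function space $\mathbb S^{\mathbf X}$; closed sets are the complements of open sets, and a name of a closed set is a name of its complement. A computable embedding of $\mathbf X$ into $\mathbf Y$ is a computable map $i\colon\mathbf X\to\mathbf Y$ with a computable inverse $i(\mathbf X)\to\mathbf X$. The space $\mathbf X$ is computably normal if every pair $(A,B)$ of disjoint closed sets admits disjoint open sets $U\supseteq A$ and $V\supseteq B$, and the multi-valued map that sends such a pair $(A,B)$ to all such pairs $(U,V)$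 is computable. For $A\subseteq\mathbb N$ let $S_A:=\{(n,\top)\mid n\in A\}\cup\{(n,\bot)\mid n\notin A\}$, regarded as a subspace of $\mathbb N\times\mathbb S$. **Proposition ($S_A$ normality).** For every $A\subseteq\mathbb N$ the following are equivalent: 1. $S_A$ computably embeds into the Hilbert cube $[0,1]^\omega$; 2. $S_A$ is computably normal; 3. $A$ is 2-c.e. (that is, in the first level of the difference hierarchy over $\Sigma^0_1$): $A=C\setminus D$ for some computably enumerable sets $C,D\subseteq\mathbb N$. -/

import Mathlib

namespace TypeTwo

universe u v

/-! Type-2 machines -/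

/-- The (code of the) finite prefix `p 0, …, p (k-1)` of a point of Baire space. -/
def prefixCode (p : ℕ → ℕ) (k : ℕ) : ℕ :=
  Encodable.encode ((List.range k).map p)

/-- The program `c`, used as a machine that reads the infinite sequence `p` one symbol at a time,
halts on input `n` with output `m`. For `k = 0, 1, 2, …` the program is run on the first `k`
symbols of `p` and on `n`; the result `0` means that the machine goes on to read the next
symbol of `p`, and a result `m + 1` means that it halts with output `m`. -/
def Outputs (c : Nat.Partrec.Code) (p : ℕ → ℕ) (n m : ℕ) : Prop :=
  ∃ k, m + 1 ∈ c.eval (Nat.pair (prefixCode p k) n) ∧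
    ∀ j < k, 0 ∈ c.eval (Nat.pair (prefixCode p j) n)

/-- The machine `c` computes the infinite sequence `q` from the infinite sequence `p`. -/
def Computes (c : Nat.Partrec.Code) (p q : ℕ → ℕ) : Prop :=
  ∀ n, Outputs c p n (q n)

theorem Outputs.unique {c : Nat.Partrec.Code} {p : ℕ → ℕ} {n m m' : ℕ}
    (h : Outputs c p n m) (h' : Outputs c p n m') : m = m' := by
  obtain ⟨k, hk, hk0⟩ := h
  obtain ⟨l, hl, hl0⟩ := h'
  rcases lt_trichotomy k l with hlt | rfl | hlt
  · exact absurd (Part.mem_unique hk (hl0 k hlt)) (Nat.succ_ne_zero m)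
  · exact Nat.succ_injective (Part.mem_unique hk hl)
  · exact absurd (Part.mem_unique hl (hk0 l hlt)) (Nat.succ_ne_zero m')

theorem Computes.unique {c : Nat.Partrec.Code} {p q q' : ℕ → ℕ}
    (h : Computes c p q) (h' : Computes c p q') : q = q' :=
  funext fun n => (h n).unique (h' n)

/-- The pairing `⟨p, q⟩` of two points of Baire space. -/
def interleave (p q : ℕ → ℕ) (n : ℕ) : ℕ :=
  if n % 2 = 0 then p (n / 2) else q (n / 2)

theorem interleave_even (p q : ℕ → ℕ) (n : ℕ) : interleave p q (2 * n) = p n := by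
  simp [interleave]

theorem interleave_odd (p q : ℕ → ℕ) (n : ℕ) : interleave p q (2 * n + 1) = q n := by
  have h1 : (2 * n + 1) % 2 = 1 := by omega
  have h2 : (2 * n + 1) / 2 = n := by omega
  simp [interleave, h1, h2]

/-- The partial function coded by `p`: the machine with index `p 0`, with oracle
`n ↦ p (n + 1)`, computes `r` from `q`. -/
def CodedComputes (p q r : ℕ → ℕ) : Prop :=
  Computes (Denumerable.ofNat Nat.Partrec.Code (p 0)) (interleave (fun n => p (n + 1)) q) r

/-! Represented spaces -/

/-- A representation of `X`: a partial surjection `δ` from Baire space to `X`, given by its graph.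
`names p x` means that `p` is a name of `x`, that is, `δ p = x`. -/
structure BaireRep (X : Type u) where
  names : (ℕ → ℕ) → X → Prop
  unique : ∀ {p x y}, names p x → names p y → x = y
  surj : ∀ x, ∃ p, names p x

/-- A multi-valued map, given by its sets of values. -/
def MultiMap (X : Type u) (Y : Type v) := X → Set Y

/-- The domain of a multi-valued map. -/
def MultiMap.dom {X : Type u} {Y : Type v} (F : MultiMap X Y) : Set X :=
  {x | (F x).Nonempty}

/-- A multi-valued map is computable if some machine computes, from each name of each point `x` of
its domain, a name of some value of the map in `x`. -/
def MultiMap.IsComputable {X : Type u} {Y : Type v} (rX : BaireRep X) (rY : BaireRep Y)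
    (F : MultiMap X Y) : Prop :=
  ∃ c : Nat.Partrec.Code, ∀ p x, rX.names p x → x ∈ F.dom →
    ∃ q, Computes c p q ∧ ∃ y ∈ F x, rY.names q y

/-- A total single-valued map is computable. -/
def IsComputableMap {X : Type u} {Y : Type v} (rX : BaireRep X) (rY : BaireRep Y)
    (f : X → Y) : Prop :=
  MultiMap.IsComputable rX rY (fun x => {f x})

/-- A total single-valued map is continuously realisable: there is a function, continuous on
the set of names of points of `X` (with the topology of Baire space), that maps names of `x`
to names of `f x`. -/
def IsContinuousMap {X : Type u} {Y : Type v} (rX : BaireRep X) (rY : BaireRep Y)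
    (f : X → Y) : Prop :=
  ∃ R : (ℕ → ℕ) → (ℕ → ℕ), ContinuousOn R {p | ∃ x, rX.names p x} ∧
    ∀ p x, rX.names p x → rY.names (R p) (f x)

/-! Every continuous function on a subset of Baire space is coded by a point of Baire space -/

section Coding

/-- The reader of a table: at stage `k` it tests one prefix of the second component. -/
def tableRead (l : List ℕ) (n : ℕ) : ℕ :=
  if 2 * (Nat.unpair l.length).1 ≤ l.length then
    l.getD (2 * Nat.pair (Encodable.encode
      ((List.range (Nat.unpair l.length).1).map fun i => l.getD (2 * i + 1) 0)) n) 0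
  else 0

theorem tableRead_primrec : Primrec₂ tableRead := by
  have hlen : Primrec fun a : List ℕ × ℕ => a.1.length := Primrec.list_length.comp Primrec.fst
  have hj : Primrec fun a : List ℕ × ℕ => (Nat.unpair a.1.length).1 :=
    Primrec.fst.comp (Primrec.unpair.comp hlen)
  have hmap : Primrec fun a : List ℕ × ℕ =>
      (List.range (Nat.unpair a.1.length).1).map fun i => a.1.getD (2 * i + 1) 0 := by
    refine Primrec.list_map (Primrec.list_range.comp hj) ?_
    refine (Primrec.list_getD 0).comp (Primrec.fst.comp Primrec.fst) ?_
    exact Primrec.succ.comp (Primrec.nat_mul.comp (Primrec.const 2) Primrec.snd)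
  refine Primrec.ite ?_ ?_ (Primrec.const 0)
  · exact Primrec.nat_le.comp (Primrec.nat_mul.comp (Primrec.const 2) hj) hlen
  · refine (Primrec.list_getD 0).comp Primrec.fst ?_
    exact Primrec.nat_mul.comp (Primrec.const 2)
      (Primrec₂.natPair.comp (Primrec.encode.comp hmap) Primrec.snd)

theorem exists_tableCode : ∃ c : Nat.Partrec.Code, ∀ (p : ℕ → ℕ) (k n m : ℕ),
    m ∈ c.eval (Nat.pair (prefixCode p k) n) ↔ m = tableRead ((List.range k).map p) n := by
  let f : ℕ → ℕ := fun z =>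
    tableRead (Denumerable.ofNat (List ℕ) (Nat.unpair z).1) (Nat.unpair z).2
  have hf : Primrec f := tableRead_primrec.comp
    ((Primrec.ofNat (List ℕ)).comp (Primrec.fst.comp Primrec.unpair))
    (Primrec.snd.comp Primrec.unpair)
  have hf' : Nat.Partrec (f : ℕ →. ℕ) := Partrec.nat_iff.1 hf.to_comp.partrec
  obtain ⟨c, hc⟩ := Nat.Partrec.Code.exists_code.1 hf'
  refine ⟨c, fun p k n m => ?_⟩
  rw [hc]
  simp [f, prefixCode, PFun.coe_val]

theorem getD_prefix (s : ℕ → ℕ) {k i : ℕ} (h : i < k) :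
    ((List.range k).map s).getD i 0 = s i := by
  simp [List.getD, h]

open Classical in
theorem exists_coding {D : Set (ℕ → ℕ)} {R : (ℕ → ℕ) → (ℕ → ℕ)} (hR : ContinuousOn R D) :
    ∃ p, ∀ q ∈ D, CodedComputes p q (R q) := by
  obtain ⟨c, hc⟩ := exists_tableCode
  -- entry `m + 1` for a prefix and an argument: all points of `D` with this prefix have value `m`
  let good : ℕ → ℕ → ℕ → ℕ → Prop := fun σ j n m =>
    ∀ q ∈ D, prefixCode q j = σ → R q n = m
  let T : ℕ → ℕ := fun t =>
    if h : ∃ m, (∃ q ∈ D, ∃ j, prefixCode q j = t.unpair.1) ∧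
        ∀ j, good t.unpair.1 j t.unpair.2 m
    then Classical.choose h + 1 else 0
  have plen : ∀ (q q' : ℕ → ℕ) j j', prefixCode q j = prefixCode q' j' → j = j' := by
    intro q q' j j' h
    have := congrArg List.length (Encodable.encode_injective h)
    simpa using this
  have T_sound : ∀ q ∈ D, ∀ j n m, T (Nat.pair (prefixCode q j) n) = m + 1 → m = R q n := by
    intro q hq j n m h
    simp only [T] at h
    split_ifs at h with h'
    · have := (Classical.choose_spec h').2 j q hq (by simp)
      rw [← Nat.succ_injective h, ← this]
      simp
  have T_compl : ∀ q ∈ D, ∀ n, ∃ j, T (Nat.pair (prefixCode q j) n) ≠ 0 := by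
    intro q hq n
    have hcont : ContinuousWithinAt (fun q => R q n) D q :=
      (continuousWithinAt_pi.1 (hR q hq)) n
    have hev : ∀ᶠ q' in nhdsWithin q D, R q' n = R q n :=
      hcont.eventually (by simp : ∀ᶠ x in nhds (R q n), x = R q n)
    rw [eventually_nhdsWithin_iff] at hev
    obtain ⟨I, u, hu, hsub⟩ := isOpen_pi_iff.1 isOpen_interior q
      (mem_interior_iff_mem_nhds.2 hev)
    obtain ⟨j, hj⟩ := I.exists_nat_subset_range
    refine ⟨j, ?_⟩
    have hex : ∃ m, (∃ q' ∈ D, ∃ j', prefixCode q' j' =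
        (Nat.pair (prefixCode q j) n).unpair.1) ∧
        ∀ j', good (Nat.pair (prefixCode q j) n).unpair.1 j'
          (Nat.pair (prefixCode q j) n).unpair.2 m := by
      refine ⟨R q n, ⟨q, hq, j, by simp⟩, fun j' q' hq' he => ?_⟩
      simp only [Nat.unpair_pair] at he ⊢
      obtain rfl := plen _ _ _ _ he
      have he' := Encodable.encode_injective he
      refine interior_subset (hsub (fun i hi => ?_)) hq'
      have hij : i < j' := Finset.mem_range.1 (hj hi)
      have : q' i = q i := by
        have := congrArg (fun l => l.getD i 0) he'
        simpa [hij] using this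
      rw [this]
      exact (hu i hi).2
    simp only [T]
    rw [dif_pos hex]
    exact Nat.succ_ne_zero _
  refine ⟨fun n => Nat.casesOn n (Encodable.encode c) T, fun q hq n => ?_⟩
  have hcode : Denumerable.ofNat Nat.Partrec.Code (Encodable.encode c) = c :=
    Denumerable.ofNat_encode c
  change Outputs (Denumerable.ofNat Nat.Partrec.Code (Encodable.encode c)) (interleave T q) n _
  rw [hcode]
  set s := interleave T q with hs
  -- the value read at stage `k`
  have hpre : ∀ k j, 2 * j ≤ k → (List.range j).map
      (fun i => ((List.range k).map s).getD (2 * i + 1) 0) = (List.range j).map q := by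
    intro k j hjk
    refine List.map_congr_left fun i hi => ?_
    have hi' : i < j := List.mem_range.1 hi
    rw [getD_prefix s (by omega), hs, interleave_odd]
  have hval : ∀ k, tableRead ((List.range k).map s) n = 0 ∨
      tableRead ((List.range k).map s) n = R q n + 1 := by
    intro k
    by_contra! hne
    obtain ⟨h0, h1⟩ := hne
    simp only [tableRead, List.length_map, List.length_range] at h0 h1
    split_ifs at h0 h1 with hle
    · rw [hpre k _ hle] at h0 h1
      by_cases hlt : 2 * Nat.pair (Encodable.encode
          ((List.range (Nat.unpair k).1).map q)) n < k
      · rw [getD_prefix s hlt, hs, interleave_even] at h0 h1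
        obtain ⟨m, hm⟩ := Nat.exists_eq_succ_of_ne_zero h0
        have := T_sound q hq _ n m hm
        exact h1 (hm.trans (by rw [this]))
      · exact h0 (List.getD_eq_default _ _ (by simpa using hlt))
    · exact h0 rfl
  have hex : ∃ k, tableRead ((List.range k).map s) n ≠ 0 := by
    obtain ⟨j, hj⟩ := T_compl q hq n
    let b := 2 * j + 2 * Nat.pair (prefixCode q j) n + 1
    have hb : b ≤ Nat.pair j b := Nat.right_le_pair j b
    refine ⟨Nat.pair j b, ?_⟩
    have hle : 2 * j ≤ Nat.pair j b := by omega
    have hlt : 2 * Nat.pair (prefixCode q j) n < Nat.pair j b := by omega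
    simp only [tableRead, List.length_map, List.length_range, Nat.unpair_pair]
    rw [if_pos hle, hpre _ _ hle]
    change ((List.range (Nat.pair j b)).map s).getD (2 * Nat.pair (prefixCode q j) n) 0 ≠ 0
    rw [getD_prefix s hlt, hs, interleave_even]
    exact hj
  refine ⟨Nat.find hex, ?_, fun j hj => ?_⟩
  · rw [hc]
    exact ((hval _).resolve_left (Nat.find_spec hex)).symm
  · rw [hc]
    exact (not_not.1 (Nat.find_min hex hj)).symm

end Coding

/-! Constructions of represented spaces -/

/-- The natural numbers: `p` is a name of `p 0`. -/
def natRep : BaireRep ℕ where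
  names p n := p 0 = n
  unique h h' := h.symm.trans h'
  surj n := ⟨fun _ => n, rfl⟩

/-- Sierpinski space: the set `{⊤, ⊥}` of truth values, where `0, 0, 0, …` is the only name
of `⊥` and all other sequences are names of `⊤`. -/
def sierpinski : BaireRep Prop where
  names p b := b = ∃ n, p n ≠ 0
  unique h h' := h.trans h'.symm
  surj b := by
    by_cases hb : b
    · exact ⟨fun _ => 1, by simp [hb]⟩
    · exact ⟨fun _ => 0, by simp [hb]⟩

/-- The rational number with number `n`, in a standard numbering of `ℚ`. -/
def ratOfNat (n : ℕ) : ℚ :=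
  ((n.unpair.1.unpair.1 : ℚ) - n.unpair.1.unpair.2) / (n.unpair.2 + 1)

theorem ratOfNat_surj (x : ℚ) : ∃ n, ratOfNat n = x := by
  have hden : ((x.den - 1 : ℕ) : ℚ) + 1 = x.den := by
    have := x.den_pos
    have h : x.den - 1 + 1 = x.den := by omega
    exact_mod_cast h
  have hx : (x.num : ℚ) / x.den = x := Rat.num_div_den x
  rcases Int.eq_nat_or_neg x.num with ⟨a, ha | ha⟩
  · refine ⟨Nat.pair (Nat.pair a 0) (x.den - 1), ?_⟩
    simp only [ratOfNat, Nat.unpair_pair, hden]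
    refine Eq.trans ?_ hx
    rw [ha]
    simp
  · refine ⟨Nat.pair (Nat.pair 0 a) (x.den - 1), ?_⟩
    simp only [ratOfNat, Nat.unpair_pair, hden]
    refine Eq.trans ?_ hx
    rw [ha]
    simp

/-- The real numbers: a name of `x` is a sequence of rational numbers that converges to `x`
with error less than `2 ^ (-n)`. -/
def realRep : BaireRep ℝ where
  names p x := ∀ n, |(ratOfNat (p n) : ℝ) - x| < (1 / 2 : ℝ) ^ n
  unique := by
    intro p x y hx hy
    have hlim : Filter.Tendsto (fun n : ℕ => (1 / 2 : ℝ) ^ n) Filter.atTop (nhds 0) :=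
      tendsto_pow_atTop_nhds_zero_of_lt_one (by norm_num) (by norm_num)
    have key : ∀ z : ℝ, (∀ n, |(ratOfNat (p n) : ℝ) - z| < (1 / 2 : ℝ) ^ n) →
        Filter.Tendsto (fun n => (ratOfNat (p n) : ℝ)) Filter.atTop (nhds z) := by
      intro z hz
      rw [tendsto_iff_norm_sub_tendsto_zero]
      exact squeeze_zero (fun _ => norm_nonneg _) (fun n => (hz n).le) hlim
    exact tendsto_nhds_unique (key x hx) (key y hy)
  surj x := by
    have h : ∀ n : ℕ, ∃ m, |(ratOfNat m : ℝ) - x| < (1 / 2 : ℝ) ^ n := by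
      intro n
      obtain ⟨r, hr⟩ := exists_rat_btwn (show x < x + (1 / 2 : ℝ) ^ n by
        have : (0 : ℝ) < (1 / 2 : ℝ) ^ n := by positivity
        linarith)
      obtain ⟨m, hm⟩ := ratOfNat_surj r
      refine ⟨m, ?_⟩
      rw [hm, abs_lt]
      have : (0 : ℝ) < (1 / 2 : ℝ) ^ n := by positivity
      constructor <;> linarith [hr.1, hr.2]
    choose p hp using h
    exact ⟨p, hp⟩

/-- The product of two represented spaces. -/
def BaireRep.prod {X : Type u} {Y : Type v} (rX : BaireRep X) (rY : BaireRep Y) :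
    BaireRep (X × Y) where
  names p z := rX.names (fun n => p (2 * n)) z.1 ∧ rY.names (fun n => p (2 * n + 1)) z.2
  unique h h' := Prod.ext (rX.unique h.1 h'.1) (rY.unique h.2 h'.2)
  surj z := by
    obtain ⟨p, hp⟩ := rX.surj z.1
    obtain ⟨q, hq⟩ := rY.surj z.2
    refine ⟨interleave p q, ?_, ?_⟩
    · simpa only [interleave_even] using hp
    · simpa only [interleave_odd] using hq

/-- The countable power `X ^ ω`: a name of a sequence consists of one name for each entry. -/
def BaireRep.pow {X : Type u} (rX : BaireRep X) : BaireRep (ℕ → X) where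
  names p x := ∀ i, rX.names (fun n => p (Nat.pair i n)) (x i)
  unique h h' := funext fun i => rX.unique (h i) (h' i)
  surj x := by
    choose p hp using fun i => rX.surj (x i)
    refine ⟨fun k => p k.unpair.1 k.unpair.2, fun i => ?_⟩
    simpa only [Nat.unpair_pair] using hp i

/-- The subspace on a subset: the names of a point are its names in the whole space. -/
def BaireRep.sub {X : Type u} (rX : BaireRep X) (S : Set X) : BaireRep S where
  names p x := rX.names p x
  unique h h' := Subtype.ext (rX.unique h h')
  surj x := rX.surj x

/-- The function space `Y ^ X` of all continuously realisable total maps; a name of `f` is a code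
of a realiser of `f`. -/
def BaireRep.functions {X : Type u} {Y : Type v} (rX : BaireRep X) (rY : BaireRep Y) :
    BaireRep {f : X → Y // IsContinuousMap rX rY f} where
  names p f := ∀ q x, rX.names q x → ∃ r, CodedComputes p q r ∧ rY.names r (f.1 x)
  unique := by
    intro p f g hf hg
    refine Subtype.ext (funext fun x => ?_)
    obtain ⟨q, hq⟩ := rX.surj x
    obtain ⟨r, hr, hrf⟩ := hf q x hq
    obtain ⟨r', hr', hrg⟩ := hg q x hq
    obtain rfl := Computes.unique hr hr'
    exact rY.unique hrf hrg
  surj := by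
    rintro ⟨f, R, hR, hRf⟩
    obtain ⟨p, hp⟩ := exists_coding hR
    exact ⟨p, fun q x hq => ⟨R q, hp q ⟨x, hq⟩, hRf q x hq⟩⟩

/-- A subset of a represented space is open if its characteristic function to Sierpinski space
is continuously realisable. -/
def IsOpenSet {X : Type u} (rX : BaireRep X) (U : Set X) : Prop :=
  IsContinuousMap rX sierpinski (fun x => x ∈ U)

/-- A subset of a represented space is closed if its complement is open. -/
def IsClosedSet {X : Type u} (rX : BaireRep X) (A : Set X) : Prop :=
  IsOpenSet rX Aᶜ

/-- The space of open sets, identified with the function space to Sierpinski space through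
characteristic functions. -/
def BaireRep.opens {X : Type u} (rX : BaireRep X) : BaireRep {U : Set X // IsOpenSet rX U} where
  names p U := (rX.functions sierpinski).names p ⟨fun x => x ∈ U.1, U.2⟩
  unique := by
    intro p U V hU hV
    have h := congrArg Subtype.val ((rX.functions sierpinski).unique hU hV)
    exact Subtype.ext (Set.ext fun x => iff_of_eq (congrFun h x))
  surj U := (rX.functions sierpinski).surj ⟨fun x => x ∈ U.1, U.2⟩

/-- The space of closed sets: a closed set is identified with its complement. -/
def BaireRep.closeds {X : Type u} (rX : BaireRep X) :
    BaireRep {A : Set X // IsClosedSet rX A} where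
  names p A := rX.opens.names p ⟨A.1ᶜ, A.2⟩
  unique := by
    intro p A B hA hB
    have h := congrArg Subtype.val (rX.opens.unique hA hB)
    exact Subtype.ext (compl_injective h)
  surj A := rX.opens.surj ⟨A.1ᶜ, A.2⟩

/-! The properties of represented spaces -/

/-- `X` computably embeds into `Y`: there is a computable map `i : X → Y` with a computable
inverse `i(X) → X`. -/
def ComputablyEmbeds {X : Type u} {Y : Type v} (rX : BaireRep X) (rY : BaireRep Y) : Prop :=
  ∃ i : X → Y, IsComputableMap rX rY i ∧
    ∃ j : Set.range i → X, (∀ x, j ⟨i x, Set.mem_range_self x⟩ = x) ∧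
      IsComputableMap (rY.sub (Set.range i)) rX j

/-- The multi-valued map that separates two closed sets by disjoint open sets. -/
def normMap {X : Type u} (rX : BaireRep X) :
    MultiMap ({A : Set X // IsClosedSet rX A} × {B : Set X // IsClosedSet rX B})
      ({U : Set X // IsOpenSet rX U} × {V : Set X // IsOpenSet rX V}) :=
  fun P => {Q | Disjoint Q.1.1 Q.2.1 ∧ P.1.1 ⊆ Q.1.1 ∧ P.2.1 ⊆ Q.2.1}

/-- A represented space is computably normal if all pairs of disjoint closed sets can be separated
by disjoint open sets, and these can be computed from the closed sets. -/
def IsComputablyNormal {X : Type u} (rX : BaireRep X) : Prop :=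
  (normMap rX).dom = {P | Disjoint P.1.1 P.2.1} ∧
    (normMap rX).IsComputable (rX.closeds.prod rX.closeds) (rX.opens.prod rX.opens)

/-- The Hilbert cube `[0,1] ^ ω`. -/
def hilbertCube : BaireRep (ℕ → Set.Icc (0 : ℝ) 1) :=
  (realRep.sub (Set.Icc 0 1)).pow

/-- The set `S_A = {(n, ⊤) | n ∈ A} ∪ {(n, ⊥) | n ∉ A}`. -/
def setS (A : Set ℕ) : Set (ℕ × Prop) :=
  {z | ∃ n ∈ A, z = (n, True)} ∪ {z | ∃ n, n ∉ A ∧ z = (n, False)}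

/-- `S_A` as a subspace of the product of the natural numbers and Sierpinski space. -/
def spaceS (A : Set ℕ) : BaireRep (setS A) :=
  (natRep.prod sierpinski).sub (setS A)

/-- A set of natural numbers is 2-c.e. if it is the difference of two computably enumerable
sets. -/
def IsTwoCE (A : Set ℕ) : Prop :=
  ∃ C D : Set ℕ, REPred (fun n => n ∈ C) ∧ REPred (fun n => n ∈ D) ∧ A = C \ D

end TypeTwo

namespace TypeTwo
open Nat.Partrec (Code)
open Nat.Partrec.Code (evaln)

/-! Over every `n` lies exactly one point of `S_A`, so every subset of `S_A` is open, and 1 and 2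
are purely questions of computability. Write `⟨n, s⟩` for `pointSeq n s`. The sequence `⟨n, 0^ω⟩`
names a point exactly if `n ∉ A`, and `⟨n, 0^t 1^ω⟩` exactly if `n ∈ A`. A machine that halts on
`⟨n, 0^ω⟩` has read only a finite prefix, which also begins some `⟨n, 0^t 1^ω⟩`; this finite use, in
`run_congr`, drives the proof.

From 3, let `A = C \ D`. Once `n` has been enumerated into `C`, membership in `A` is decidable from
a name of the point: either a nonzero symbol appears in the name, or `n` appears in `D`. For the
embedding, coordinates coding `n` are joined by the bits `n ∈ C_k ∧ n ∈ A`, where `C_k` is the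
`k`-th stage of `C` (`computablyEmbeds_of_isTwoCE`). For normality, the side chosen for `n` must not
depend on the name. A choice found on `⟨n, 0^ω⟩` before `n` enters `C` is final; otherwise one waits
until `n ∈ A` is decided (`exists_verdict`).

Towards 3, `C` collects those `n` for which the given machines, fed as if `n ∈ A`, behave
accordingly for finitely many steps. `D` collects those `n` for which this behaviour is contradicted
by what the machines do on some `⟨n, 0^t 1^ω⟩`. If `n ∈ A`, all these sequences name one point and
no contradiction arises. If `n ∈ C` but `n ∉ A`, the true name `⟨n, 0^ω⟩` yields a contradiction
after finitely many steps, hence so does `⟨n, 0^t 1^ω⟩` for large `t`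
(`isTwoCE_of_computablyEmbeds`, `isTwoCE_of_isComputablyNormal`). -/

/-! Stage functions of Type-2 machines -/

/-- The first nonzero value among `f 0, …, f (k-1)`, or `0` if there is none. -/
def firstNonzero (f : ℕ → ℕ) : ℕ → ℕ
  | 0 => 0
  | k + 1 => if firstNonzero f k = 0 then f k else firstNonzero f k

theorem firstNonzero_eq_zero {f : ℕ → ℕ} {k : ℕ} :
    firstNonzero f k = 0 ↔ ∀ i < k, f i = 0 := by
  induction k with
  | zero => simp [firstNonzero]
  | succ k ih =>
    rw [firstNonzero]
    split_ifs with h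
    · rw [Nat.forall_lt_succ_right]
      exact ⟨fun h' => ⟨ih.1 h, h'⟩, fun h' => h'.2⟩
    · exact ⟨fun h' => absurd h' h, fun h' => ih.2 fun i hi => h' i (by omega)⟩

theorem firstNonzero_eq {f : ℕ → ℕ} {k m : ℕ} (hm : m ≠ 0) :
    firstNonzero f k = m ↔ ∃ i < k, f i = m ∧ ∀ j < i, f j = 0 := by
  induction k with
  | zero => simp [firstNonzero, hm.symm]
  | succ k ih =>
    rw [firstNonzero]
    split_ifs with h
    · rw [firstNonzero_eq_zero] at h
      constructor
      · intro h'
        exact ⟨k, Nat.lt_succ_self k, h', h⟩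
      · rintro ⟨i, hi, hi', -⟩
        rcases Nat.lt_succ_iff_lt_or_eq.1 hi with h1 | rfl
        · exact absurd (hi'.symm.trans (h i h1)) hm
        · exact hi'
    · rw [ih]
      constructor
      · rintro ⟨i, hi, h'⟩
        exact ⟨i, by omega, h'⟩
      · rintro ⟨i, hi, hi', h'⟩
        rcases Nat.lt_succ_iff_lt_or_eq.1 hi with h1 | rfl
        · exact ⟨i, h1, hi', h'⟩
        · exact absurd (firstNonzero_eq_zero.2 h') h

theorem firstNonzero_congr {f g : ℕ → ℕ} {k : ℕ} (h : ∀ i < k, f i = g i) :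
    firstNonzero f k = firstNonzero g k := by
  induction k with
  | zero => rfl
  | succ k ih =>
    rw [firstNonzero, firstNonzero, ih fun i hi => h i (by omega), h k (Nat.lt_succ_self k)]

theorem firstNonzero_mono {f : ℕ → ℕ} {k l : ℕ} (hkl : k ≤ l) (h : firstNonzero f k ≠ 0) :
    firstNonzero f l = firstNonzero f k := by
  obtain ⟨i, hi, h'⟩ := (firstNonzero_eq h).1 rfl
  exact (firstNonzero_eq h).2 ⟨i, by omega, h'⟩

theorem firstNonzero_unique {f : ℕ → ℕ} {k l : ℕ} (h : firstNonzero f k ≠ 0)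
    (h' : firstNonzero f l ≠ 0) : firstNonzero f k = firstNonzero f l := by
  rcases le_total k l with hkl | hkl
  · exact (firstNonzero_mono hkl h).symm
  · exact firstNonzero_mono hkl h'

section Primrec

variable {α : Type*} [Primcodable α]

theorem primrec_firstNonzero {f : α → ℕ → ℕ} {k : α → ℕ} (hf : Primrec₂ f) (hk : Primrec k) :
    Primrec fun a => firstNonzero (f a) (k a) := by
  have : Primrec fun a => (Nat.rec 0 (fun i r => if r = 0 then f a i else r) (k a) : ℕ) := by
    refine Primrec.nat_rec' hk (Primrec.const 0) (h := fun a x => if x.2 = 0 then f a x.1 else x.2) ?_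
    refine Primrec.ite (Primrec.eq.comp (Primrec.snd.comp Primrec.snd) (Primrec.const 0)) ?_
      (Primrec.snd.comp Primrec.snd)
    exact hf.comp Primrec.fst (Primrec.fst.comp Primrec.snd)
  refine this.of_eq fun a => ?_
  induction k a with
  | zero => rfl
  | succ k ih =>
    rw [firstNonzero, ← ih]

theorem primrecPred_exists_lt {R : α → ℕ → Prop} {k : α → ℕ} (hR : PrimrecRel R)
    (hk : Primrec k) : PrimrecPred fun a => ∃ i < k a, R a i := by
  have h := hR.swap.exists_mem_list
  exact (h.comp (Primrec.list_range.comp hk) Primrec.id).of_eq fun a => by simp [Function.swap]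

theorem primrecPred_forall_lt {R : α → ℕ → Prop} {k : α → ℕ} (hR : PrimrecRel R)
    (hk : Primrec k) : PrimrecPred fun a => ∀ i < k a, R a i := by
  have h := hR.swap.forall_mem_list
  exact (h.comp (Primrec.list_range.comp hk) Primrec.id).of_eq fun a => by simp [Function.swap]

theorem primrec_prefixCode {p : α → ℕ → ℕ} {k : α → ℕ} (hp : Primrec₂ p) (hk : Primrec k) :
    Primrec fun a => prefixCode (p a) (k a) :=
  Primrec.encode.comp (Primrec.list_map (Primrec.list_range.comp hk) hp)

end Primrec

theorem prefixCode_congr {p p' : ℕ → ℕ} {k : ℕ} (h : ∀ i < k, p i = p' i) :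
    prefixCode p k = prefixCode p' k := by
  unfold prefixCode
  congr 1
  exact List.map_congr_left fun i hi => h i (List.mem_range.1 hi)

/-- The result of `s` steps of the machine `c` with input sequence `p` for the argument `n`:
`m + 1` if it has halted with output `m`, and `0` if it has not halted. -/
def run (c : Code) (p : ℕ → ℕ) (s n : ℕ) : ℕ :=
  -- All values are shifted by one: an unfinished evaluation counts as `1` and stops the search, a
  -- request to read on as `0`, and an output `m` as `m + 2`. The final subtraction sends both ways
  -- of not having halted to `0`.
  firstNonzero (fun k => (evaln s c (Nat.pair (prefixCode p k) n)).elim 1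
    fun v => if v = 0 then 0 else v + 1) (s + 1) - 1

theorem run_eq_succ {c : Code} {p : ℕ → ℕ} {s n m : ℕ} :
    run c p s n = m + 1 ↔ ∃ k ≤ s, m + 1 ∈ evaln s c (Nat.pair (prefixCode p k) n) ∧
      ∀ j < k, 0 ∈ evaln s c (Nat.pair (prefixCode p j) n) := by
  have h1 : run c p s n = m + 1 ↔ firstNonzero (fun k =>
      (evaln s c (Nat.pair (prefixCode p k) n)).elim 1
        fun v => if v = 0 then 0 else v + 1) (s + 1) = m + 2 := by
    unfold run
    omega
  rw [h1, firstNonzero_eq (by omega)]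
  have h0 : ∀ o : Option ℕ, (o.elim 1 fun v => if v = 0 then 0 else v + 1) = 0 ↔ 0 ∈ o := by
    rintro (_ | v)
    · simp
    · simp
  have hs : ∀ o : Option ℕ, (o.elim 1 fun v => if v = 0 then 0 else v + 1) = m + 2 ↔
      m + 1 ∈ o := by
    rintro (_ | v)
    · simp
    · by_cases hv : v = 0 <;> simp [hv]
  simp only [h0, hs, Nat.lt_succ_iff]

theorem run_mono {c : Code} {p : ℕ → ℕ} {s t n : ℕ} (hst : s ≤ t) (h : run c p s n ≠ 0) :
    run c p t n = run c p s n := by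
  obtain ⟨m, hm⟩ := Nat.exists_eq_succ_of_ne_zero h
  rw [hm]
  obtain ⟨k, hk, h1, h2⟩ := run_eq_succ.1 hm
  exact run_eq_succ.2 ⟨k, hk.trans hst, Nat.Partrec.Code.evaln_mono hst h1,
    fun j hj => Nat.Partrec.Code.evaln_mono hst (h2 j hj)⟩

/-- Finite use: `s` steps inspect only prefixes of length at most `s`. -/
theorem run_congr {c : Code} {p p' : ℕ → ℕ} {s n : ℕ} (h : ∀ i < s, p i = p' i) :
    run c p s n = run c p' s n := by
  unfold run
  rw [firstNonzero_congr]
  intro k hk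
  rw [prefixCode_congr fun i hi => h i (by omega)]

theorem outputs_iff_run {c : Code} {p : ℕ → ℕ} {n m : ℕ} :
    Outputs c p n m ↔ ∃ s, run c p s n = m + 1 := by
  constructor
  · rintro ⟨k, hk, hj⟩
    have key : ∀ l ≤ k, ∃ s, ∀ j < l, 0 ∈ evaln s c (Nat.pair (prefixCode p j) n) := by
      intro l
      induction l with
      | zero => exact fun _ => ⟨0, fun j hj => absurd hj (Nat.not_lt_zero j)⟩
      | succ l ih =>
        intro hl
        obtain ⟨s, hs⟩ := ih (by omega)
        obtain ⟨t, ht⟩ := Nat.Partrec.Code.evaln_complete.1 (hj l (by omega))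
        refine ⟨max s t, fun j hj => ?_⟩
        rcases Nat.lt_succ_iff_lt_or_eq.1 hj with h | rfl
        · exact Nat.Partrec.Code.evaln_mono (le_max_left s t) (hs j h)
        · exact Nat.Partrec.Code.evaln_mono (le_max_right s t) ht
    obtain ⟨s, hs⟩ := key k le_rfl
    obtain ⟨t, ht⟩ := Nat.Partrec.Code.evaln_complete.1 hk
    refine ⟨max k (max s t), run_eq_succ.2 ⟨k, le_max_left _ _, ?_, fun j hj => ?_⟩⟩
    · exact Nat.Partrec.Code.evaln_mono (by omega) ht
    · exact Nat.Partrec.Code.evaln_mono (by omega) (hs j hj)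
  · rintro ⟨s, hs⟩
    obtain ⟨k, -, h1, h2⟩ := run_eq_succ.1 hs
    exact ⟨k, Nat.Partrec.Code.evaln_sound h1, fun j hj => Nat.Partrec.Code.evaln_sound (h2 j hj)⟩

theorem Computes.run_eq {c : Code} {p q : ℕ → ℕ} (h : Computes c p q) {s n : ℕ}
    (hs : run c p s n ≠ 0) : run c p s n = q n + 1 := by
  obtain ⟨m, hm⟩ := Nat.exists_eq_succ_of_ne_zero hs
  rw [hm, (h n).unique (outputs_iff_run.2 ⟨s, hm⟩)]

theorem Computes.exists_run {c : Code} {p q : ℕ → ℕ} (h : Computes c p q) (n : ℕ) :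
    ∃ s, run c p s n = q n + 1 :=
  outputs_iff_run.1 (h n)

theorem Computes.exists_run_lt {c : Code} {p q : ℕ → ℕ} (h : Computes c p q) (f : ℕ → ℕ)
    (b : ℕ) : ∃ s, ∀ n < b, run c p s (f n) = q (f n) + 1 := by
  induction b with
  | zero => exact ⟨0, fun n hn => absurd hn (Nat.not_lt_zero n)⟩
  | succ b ih =>
    obtain ⟨s, hs⟩ := ih
    obtain ⟨t, ht⟩ := h.exists_run (f b)
    refine ⟨max s t, fun n hn => ?_⟩
    rcases Nat.lt_succ_iff_lt_or_eq.1 hn with h' | rfl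
    · rw [run_mono (le_max_left s t) (by rw [hs n h']; omega), hs n h']
    · rw [run_mono (le_max_right s t) (by rw [ht]; omega), ht]

theorem primrec_run {α : Type*} [Primcodable α] {c : α → Code} {p : α → ℕ → ℕ} {s n : α → ℕ}
    (hc : Primrec c) (hp : Primrec₂ p) (hs : Primrec s) (hn : Primrec n) :
    Primrec fun a => run (c a) (p a) (s a) (n a) := by
  have hpre : Primrec fun x : α × ℕ => prefixCode (p x.1) x.2 := by
    refine primrec_prefixCode (p := fun x : α × ℕ => p x.1) ?_ Primrec.snd
    exact hp.comp (Primrec.fst.comp Primrec.fst) Primrec.snd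
  have hev : Primrec fun x : α × ℕ =>
      evaln (s x.1) (c x.1) (Nat.pair (prefixCode (p x.1) x.2) (n x.1)) :=
    Nat.Partrec.Code.primrec_evaln.comp (Primrec.pair (Primrec.pair (hs.comp Primrec.fst)
      (hc.comp Primrec.fst)) (Primrec₂.natPair.comp hpre (hn.comp Primrec.fst)))
  have hbody : Primrec fun x : α × ℕ =>
      (evaln (s x.1) (c x.1) (Nat.pair (prefixCode (p x.1) x.2) (n x.1))).elim 1
        fun v => if v = 0 then 0 else v + 1 := by
    refine (Primrec.option_casesOn hev (Primrec.const 1)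
      (g := fun _ v => if v = 0 then 0 else v + 1) ?_).of_eq fun x => ?_
    · exact Primrec.ite (Primrec.eq.comp Primrec.snd (Primrec.const 0)) (Primrec.const 0)
        (Primrec.succ.comp Primrec.snd)
    · cases evaln (s x.1) (c x.1) (Nat.pair (prefixCode (p x.1) x.2) (n x.1)) <;> rfl
  exact Primrec.pred.comp (primrec_firstNonzero hbody.to₂ (Primrec.succ.comp hs))

/-- A machine from a primitive recursive functional `W`, where `W p k n` is the result on the
argument `n` after reading `k` symbols of `p`: `0` for no result yet, `m + 1` for `m`. -/
theorem exists_code_of_primrec (W : (ℕ → ℕ) → ℕ → ℕ → ℕ)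
    (hW : Primrec fun a : List ℕ × ℕ => W (fun i => a.1.getD i 0) a.1.length a.2)
    (hcongr : ∀ p p' k n, (∀ i < k, p i = p' i) → W p k n = W p' k n) :
    ∃ c : Code, ∀ p n m, (∃ k, W p k n ≠ 0) → (∀ k, W p k n ≠ 0 → W p k n = m + 1) →
      Outputs c p n m := by
  let f : ℕ → ℕ := fun z =>
    W (fun i => (Denumerable.ofNat (List ℕ) z.unpair.1).getD i 0)
      (Denumerable.ofNat (List ℕ) z.unpair.1).length z.unpair.2
  have hf : Primrec f := hW.comp (Primrec.pair
    ((Primrec.ofNat (List ℕ)).comp (Primrec.fst.comp Primrec.unpair))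
    (Primrec.snd.comp Primrec.unpair))
  have hf' : Nat.Partrec (f : ℕ →. ℕ) := Partrec.nat_iff.1 hf.to_comp.partrec
  obtain ⟨c, hc⟩ := Nat.Partrec.Code.exists_code.1 hf'
  have hval : ∀ p k n, f (Nat.pair (prefixCode p k) n) = W p k n := by
    intro p k n
    simp only [f, prefixCode, Nat.unpair_pair, Denumerable.ofNat_encode, List.length_map,
      List.length_range]
    -- Past its length the list reads as `0`; by `hcongr` this padding has no effect on `W`.
    exact hcongr _ _ _ _ fun i hi => getD_prefix p hi
  have hmem : ∀ p k n m, m ∈ c.eval (Nat.pair (prefixCode p k) n) ↔ m = W p k n := by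
    intro p k n m
    rw [hc, ← hval]
    simp [PFun.coe_val]
  refine ⟨c, fun p n m hex huniq => ⟨Nat.find hex, ?_, fun j hj => ?_⟩⟩
  · rw [hmem]
    exact (huniq _ (Nat.find_spec hex)).symm
  · rw [hmem]
    exact (not_not.1 (Nat.find_min hex hj)).symm

/-! Recursively enumerable sets and stages -/

/-- Unbounded search through the codes of `β`. A number that codes nothing is read as `default`, so
the search is over a total primitive recursive test. -/
theorem rePred_exists {α β : Type*} [Primcodable α] [Primcodable β] [Inhabited β]
    {R : α → β → Prop} (hR : PrimrecRel R) : REPred fun a => ∃ b, R a b := by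
  classical
  have hg : Primrec fun n : ℕ => (Encodable.decode (α := β) n).getD default :=
    Primrec.option_getD.comp Primrec.decode (Primrec.const default)
  have hR' : PrimrecRel fun a (n : ℕ) => R a ((Encodable.decode (α := β) n).getD default) :=
    hR.comp Primrec.fst (hg.comp Primrec.snd)
  have h : Partrec fun a => Nat.rfind (PFun.lift fun n =>
      decide (R a ((Encodable.decode (α := β) n).getD default))) :=
    Partrec.rfind (Computable₂.partrec₂
      (f := fun a n => decide (R a ((Encodable.decode (α := β) n).getD default)))
      hR'.decide.to_comp)
  refine h.dom_re.of_eq fun a => Nat.rfind_dom.trans ?_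
  constructor
  · rintro ⟨n, hn, -⟩
    exact ⟨_, by simpa using hn⟩
  · rintro ⟨b, hb⟩
    exact ⟨Encodable.encode b, by simpa using hb, fun _ => trivial⟩

/-- The stages of a computable enumeration of the set `C`. -/
structure IsEnumeration (C : Set ℕ) (e : ℕ → ℕ → Bool) : Prop where
  primrec : Primrec₂ e
  mono : ∀ {s t n}, s ≤ t → e s n = true → e t n = true
  mem_iff : ∀ n, n ∈ C ↔ ∃ s, e s n = true

theorem exists_isEnumeration {C : Set ℕ} (hC : REPred fun n => n ∈ C) :
    ∃ e, IsEnumeration C e := by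
  have hp : Partrec fun n : ℕ => (Part.assert (n ∈ C) fun _ => Part.some ()).map fun _ => 0 :=
    Partrec.map hC (Computable.const 0).to₂
  obtain ⟨c, hc⟩ := Nat.Partrec.Code.exists_code.1 (Partrec.nat_iff.1 hp)
  refine ⟨fun s n => (evaln s c n).isSome, ?_, ?_, fun n => ?_⟩
  · exact Primrec.option_isSome.comp (Nat.Partrec.Code.primrec_evaln.comp
      (Primrec.pair (Primrec.pair Primrec.fst (Primrec.const c)) Primrec.snd))
  · intro s t n hst h
    obtain ⟨x, hx⟩ := Option.isSome_iff_exists.1 h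
    exact Option.isSome_iff_exists.2 ⟨x, Nat.Partrec.Code.evaln_mono hst hx⟩
  · have h1 : n ∈ C ↔ (c.eval n).Dom := by
      rw [hc]
      simp [Part.assert]
    rw [h1, Part.dom_iff_mem]
    simp only [Option.isSome_iff_exists]
    rw [exists_comm]
    exact exists_congr fun x => Nat.Partrec.Code.evaln_complete

/-! Points and names of `S_A` -/

/-- The point of `S_A` over `n`. -/
def pointS (A : Set ℕ) (n : ℕ) : setS A :=
  ⟨(n, n ∈ A), by
    by_cases h : n ∈ A
    · exact Or.inl ⟨n, h, by simp [h]⟩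
    · exact Or.inr ⟨n, h, by simp [h]⟩⟩

/-- As a set `S_A` is just a copy of `ℕ`; only its names depend on `A`. -/
theorem eq_pointS {A : Set ℕ} (x : setS A) : x = pointS A x.1.1 := by
  refine Subtype.ext ?_
  rcases x.2 with ⟨n, hn, h⟩ | ⟨n, hn, h⟩ <;> simp [pointS, h, hn]

theorem names_spaceS {A : Set ℕ} {p : ℕ → ℕ} {x : setS A} :
    (spaceS A).names p x ↔ p 0 = x.1.1 ∧ (x.1.1 ∈ A ↔ ∃ k, p (2 * k + 1) ≠ 0) := by
  obtain ⟨n, rfl⟩ : ∃ n, x = pointS A n := ⟨_, eq_pointS x⟩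
  change (p (2 * 0) = n ∧ (n ∈ A) = ∃ k, p (2 * k + 1) ≠ 0) ↔ _
  simp [pointS]

/-- The sequence `⟨n n n …, s⟩`; it is a name of the point over `n` if `s` is a name of the truth
value of `n ∈ A`. -/
def pointSeq (n : ℕ) (s : ℕ → ℕ) : ℕ → ℕ :=
  interleave (fun _ => n) s

theorem pointSeq_zero (n : ℕ) (s : ℕ → ℕ) : pointSeq n s 0 = n :=
  interleave_even (fun _ => n) s 0

theorem pointSeq_odd (n : ℕ) (s : ℕ → ℕ) (k : ℕ) : pointSeq n s (2 * k + 1) = s k :=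
  interleave_odd (fun _ => n) s k

theorem names_pointSeq {A : Set ℕ} {n : ℕ} {s : ℕ → ℕ} :
    (spaceS A).names (pointSeq n s) (pointS A n) ↔ (n ∈ A ↔ ∃ k, s k ≠ 0) := by
  simp [names_spaceS, pointSeq_zero, pointSeq_odd, pointS]

theorem interleave_congr {p p' q q' : ℕ → ℕ} {k : ℕ} (hp : ∀ i < k, p i = p' i)
    (hq : ∀ i < k, q i = q' i) : ∀ i < k, interleave p q i = interleave p' q' i := by
  intro i hi
  unfold interleave
  rw [hp _ (by omega), hq _ (by omega)]

theorem primrec_interleave {α : Type*} [Primcodable α] {p q : α → ℕ → ℕ} (hp : Primrec₂ p)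
    (hq : Primrec₂ q) : Primrec₂ fun a => interleave (p a) (q a) := by
  have hd : Primrec fun x : α × ℕ => x.2 / 2 :=
    Primrec.nat_div.comp Primrec.snd (Primrec.const 2)
  exact Primrec.ite (Primrec.eq.comp (Primrec.nat_mod.comp Primrec.snd (Primrec.const 2))
    (Primrec.const 0)) (hp.comp Primrec.fst hd) (hq.comp Primrec.fst hd)

theorem primrec_pointSeq {α : Type*} [Primcodable α] {n : α → ℕ} {s : α → ℕ → ℕ}
    (hn : Primrec n) (hs : Primrec₂ s) : Primrec₂ fun a => pointSeq (n a) (s a) :=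
  primrec_interleave (p := fun a _ => n a) (hn.comp Primrec.fst).to₂ hs

/-! Embedding of `S_A` for 2-c.e. sets `A` -/

theorem ratOfNat_zero : ratOfNat 0 = 0 := by
  simp [ratOfNat]

theorem ratOfNat_one : ratOfNat (Nat.pair (Nat.pair 1 0) 0) = 1 := by
  simp [ratOfNat]

/-- The number of the rational number `0` or `1` for a truth value. -/
def bitCode (b : Prop) [Decidable b] : ℕ :=
  if b then Nat.pair (Nat.pair 1 0) 0 else 0

/-- The rational number with number `a` is larger than `1 / 2`. -/
def IsBig (a : ℕ) : Prop :=
  2 * a.unpair.1.unpair.2 + a.unpair.2 + 1 < 2 * a.unpair.1.unpair.1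

instance : DecidablePred IsBig := fun a =>
  inferInstanceAs (Decidable (2 * a.unpair.1.unpair.2 + a.unpair.2 + 1 < 2 * a.unpair.1.unpair.1))

theorem primrecPred_isBig : PrimrecPred IsBig := by
  have h1 : Primrec fun a : ℕ => a.unpair.1.unpair := Primrec.unpair.comp
    (Primrec.fst.comp Primrec.unpair)
  exact Primrec.nat_lt.comp (Primrec.succ.comp (Primrec.nat_add.comp
    (Primrec.nat_double.comp (Primrec.snd.comp h1)) (Primrec.snd.comp Primrec.unpair)))
    (Primrec.nat_double.comp (Primrec.fst.comp h1))

theorem isBig_iff {a : ℕ} : IsBig a ↔ (1 / 2 : ℝ) < ratOfNat a := by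
  have h : (0 : ℝ) < (a.unpair.2 : ℝ) + 1 := by positivity
  unfold IsBig ratOfNat
  push_cast
  rw [lt_div_iff₀ h, ← @Nat.cast_lt ℝ]
  push_cast
  constructor <;> intro h' <;> linarith

/-- Entry `2` of a real's name has error below `1 / 4`, so comparison with `1 / 2` decides a
coordinate known to be `0` or `1`. -/
theorem isBig_of_near {a : ℕ} {b : Prop} [Decidable b]
    (h : |(ratOfNat a : ℝ) - (if b then 1 else 0)| < (1 / 2 : ℝ) ^ 2) : IsBig a ↔ b := by
  rw [isBig_iff]
  rw [abs_lt] at h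
  by_cases hb : b
  · simp only [hb, if_true, iff_true] at h ⊢
    linarith [h.1]
  · simp only [hb, if_false, iff_false] at h ⊢
    linarith [h.2]

/-- The image of the point over `n` in the Hilbert cube: the coordinates with even index code `n`,
and the others are the values `[n ∈ C_k ∧ n ∈ A]`. -/
noncomputable def cubeBit (A : Set ℕ) (eC : ℕ → ℕ → Bool) (n k : ℕ) : Prop :=
  if k % 2 = 0 then k / 2 = n else eC (k / 2) n = true ∧ n ∈ A

/-- The machine for the embedding. -/
def embedStep (eC eD : ℕ → ℕ → Bool) (p : ℕ → ℕ) (k z : ℕ) : ℕ :=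
  if k = 0 then 0
  else if z.unpair.1 % 2 = 0 then bitCode (z.unpair.1 / 2 = p 0) + 1
  else if eC (z.unpair.1 / 2) (p 0) = false then bitCode False + 1
  else if ∃ i < k, i % 2 = 1 ∧ p i ≠ 0 then bitCode True + 1
  else if eD k (p 0) = true then bitCode False + 1
  else 0

/-- The machine for the inverse of the embedding. -/
def unembedStep (q : ℕ → ℕ) (k z : ℕ) : ℕ :=
  if z % 2 = 0 then
    firstNonzero (fun i => if Nat.pair (2 * i) 2 < k ∧ IsBig (q (Nat.pair (2 * i) 2))
      then i + 1 else 0) k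
  else if Nat.pair z 2 < k then (if IsBig (q (Nat.pair z 2)) then 2 else 1)
  else 0

theorem primrec_embedStep {eC eD : ℕ → ℕ → Bool} (hC : Primrec₂ eC) (hD : Primrec₂ eD) :
    Primrec fun a : List ℕ × ℕ => embedStep eC eD (fun i => a.1.getD i 0) a.1.length a.2 := by
  have hlen : Primrec fun a : List ℕ × ℕ => a.1.length := Primrec.list_length.comp Primrec.fst
  have h0 : Primrec fun a : List ℕ × ℕ => a.1.getD 0 0 :=
    (Primrec.list_getD 0).comp Primrec.fst (Primrec.const 0)
  have hz : Primrec fun a : List ℕ × ℕ => a.2.unpair.1 :=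
    Primrec.fst.comp (Primrec.unpair.comp Primrec.snd)
  have hz2 : Primrec fun a : List ℕ × ℕ => a.2.unpair.1 / 2 :=
    Primrec.nat_div.comp hz (Primrec.const 2)
  have hex : PrimrecPred fun a : List ℕ × ℕ =>
      ∃ i < a.1.length, i % 2 = 1 ∧ a.1.getD i 0 ≠ 0 := by
    refine primrecPred_exists_lt
      (R := fun (a : List ℕ × ℕ) i => i % 2 = 1 ∧ a.1.getD i 0 ≠ 0) ?_ hlen
    exact (Primrec.eq.comp (Primrec.nat_mod.comp Primrec.snd (Primrec.const 2))
      (Primrec.const 1)).and (Primrec.eq.comp ((Primrec.list_getD 0).comp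
        (Primrec.fst.comp Primrec.fst) Primrec.snd) (Primrec.const 0)).not
  refine Primrec.ite (Primrec.eq.comp hlen (Primrec.const 0)) (Primrec.const 0) ?_
  refine Primrec.ite (Primrec.eq.comp (Primrec.nat_mod.comp hz (Primrec.const 2))
    (Primrec.const 0)) ?_ ?_
  · exact Primrec.succ.comp (Primrec.ite (Primrec.eq.comp hz2 h0) (Primrec.const _)
      (Primrec.const _))
  refine Primrec.ite (Primrec.eq.comp (hC.comp hz2 h0) (Primrec.const false)) (Primrec.const _) ?_
  refine Primrec.ite hex (Primrec.const _) ?_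
  exact Primrec.ite (Primrec.eq.comp (hD.comp hlen h0) (Primrec.const true)) (Primrec.const _)
    (Primrec.const 0)

theorem primrec_unembedStep :
    Primrec fun a : List ℕ × ℕ => unembedStep (fun i => a.1.getD i 0) a.1.length a.2 := by
  have hlen : Primrec fun a : List ℕ × ℕ => a.1.length := Primrec.list_length.comp Primrec.fst
  refine Primrec.ite (Primrec.eq.comp (Primrec.nat_mod.comp Primrec.snd (Primrec.const 2))
    (Primrec.const 0)) ?_ ?_
  · refine primrec_firstNonzero (f := fun (a : List ℕ × ℕ) i =>
      if Nat.pair (2 * i) 2 < a.1.length ∧ IsBig (a.1.getD (Nat.pair (2 * i) 2) 0)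
      then i + 1 else 0) ?_ hlen
    have hp : Primrec fun x : (List ℕ × ℕ) × ℕ => Nat.pair (2 * x.2) 2 :=
      Primrec₂.natPair.comp (Primrec.nat_double.comp Primrec.snd) (Primrec.const 2)
    exact Primrec.ite ((Primrec.nat_lt.comp hp (hlen.comp Primrec.fst)).and
      (primrecPred_isBig.comp ((Primrec.list_getD 0).comp (Primrec.fst.comp Primrec.fst) hp)))
      (Primrec.succ.comp Primrec.snd) (Primrec.const 0)
  · have hp : Primrec fun x : List ℕ × ℕ => Nat.pair x.2 2 :=
      Primrec₂.natPair.comp Primrec.snd (Primrec.const 2)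
    exact Primrec.ite (Primrec.nat_lt.comp hp hlen)
      (Primrec.ite (primrecPred_isBig.comp ((Primrec.list_getD 0).comp Primrec.fst hp))
        (Primrec.const 2) (Primrec.const 1)) (Primrec.const 0)

theorem embedStep_congr {eC eD : ℕ → ℕ → Bool} (p p' : ℕ → ℕ) (k z : ℕ)
    (h : ∀ i < k, p i = p' i) : embedStep eC eD p k z = embedStep eC eD p' k z := by
  unfold embedStep
  by_cases hk : k = 0
  · simp [hk]
  · have hex : (∃ i < k, i % 2 = 1 ∧ p i ≠ 0) ↔ ∃ i < k, i % 2 = 1 ∧ p' i ≠ 0 :=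
      exists_congr fun i => and_congr_right fun hi => by rw [h i hi]
    simp only [h 0 (by omega), hex]

theorem unembedStep_congr (p p' : ℕ → ℕ) (k z : ℕ)
    (h : ∀ i < k, p i = p' i) : unembedStep p k z = unembedStep p' k z := by
  have hb : ∀ i, (i < k ∧ IsBig (p i)) ↔ i < k ∧ IsBig (p' i) :=
    fun i => and_congr_right fun hi => by rw [h i hi]
  unfold unembedStep
  simp only [hb]
  split_ifs with h1 h2 h3 h4 h4 <;> try rfl
  · exact absurd (h _ h2 ▸ h3) h4
  · exact absurd (h _ h2 ▸ h4) h3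

/-- At coordinate `2 * k + 1` the bit is `0` at once if `n` is not in stage `k` of `C`. Otherwise `n
∈ C`, and exactly one of two searches succeeds: for a nonzero symbol in the name (bit `1`), or for
`n` in `D` (bit `0`). Conversely, `n` is read off the only even coordinate with value `1`, and the
odd coordinates form a Sierpinski name of `n ∈ A`, because an element of `A` lies in some stage of
`C`. -/
theorem computablyEmbeds_of_isTwoCE {A : Set ℕ} (hA : IsTwoCE A) :
    ComputablyEmbeds (spaceS A) hilbertCube := by
  classical
  obtain ⟨C, D, hC, hD, rfl⟩ := hA
  obtain ⟨eC, hC⟩ := exists_isEnumeration hC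
  obtain ⟨eD, hD⟩ := exists_isEnumeration hD
  set A := C \ D with hA
  let i : setS A → ℕ → Set.Icc (0 : ℝ) 1 := fun x k =>
    ⟨if cubeBit A eC x.1.1 k then 1 else 0, by split_ifs <;> norm_num⟩
  have hi : Function.Injective i := by
    intro x y hxy
    have h : ∀ k, cubeBit A eC x.1.1 k ↔ cubeBit A eC y.1.1 k := by
      intro k
      have := congrArg Subtype.val (congrFun hxy k)
      simp only [i] at this
      split_ifs at this with h1 h2 h2 <;> simp_all
    have h1 := h (2 * x.1.1)
    simp only [cubeBit, Nat.mul_mod_right, if_true] at h1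
    rw [eq_pointS x, eq_pointS y, show x.1.1 = y.1.1 by omega]
  refine ⟨i, ?_, fun y => y.2.choose, fun x => hi (Set.mem_range_self (f := i) x).choose_spec, ?_⟩
  · obtain ⟨c, hc⟩ := exists_code_of_primrec (embedStep eC eD)
      (primrec_embedStep hC.primrec hD.primrec) embedStep_congr
    refine ⟨c, fun p x hp _ => ?_⟩
    obtain ⟨hp0, hpA⟩ := names_spaceS.1 hp
    refine ⟨fun z => bitCode (cubeBit A eC x.1.1 z.unpair.1), fun z => ?_, i x, rfl, ?_⟩
    · have hodd : (∃ k, p (2 * k + 1) ≠ 0) ↔ ∃ k i, i < k ∧ i % 2 = 1 ∧ p i ≠ 0 := by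
        constructor
        · rintro ⟨k, hk⟩
          exact ⟨2 * k + 2, 2 * k + 1, by omega, by omega, hk⟩
        · rintro ⟨k, i, -, h1, h2⟩
          exact ⟨i / 2, by rwa [show 2 * (i / 2) + 1 = i by omega]⟩
      rw [hodd] at hpA
      apply hc
      · by_cases h1 : z.unpair.1 % 2 = 0
        · exact ⟨1, by simp [embedStep, h1]⟩
        cases h2 : eC (z.unpair.1 / 2) (p 0)
        · exact ⟨1, by simp [embedStep, h1, h2]⟩
        by_cases h3 : x.1.1 ∈ A
        · obtain ⟨k, i, hik, h⟩ := hpA.1 h3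
          refine ⟨k, ?_⟩
          simp only [embedStep]
          rw [if_neg (by omega), if_neg h1, if_neg (by simp [h2]), if_pos ⟨i, hik, h⟩]
          omega
        · have hxC : x.1.1 ∈ C := (hC.mem_iff _).2 ⟨_, hp0 ▸ h2⟩
          have hxD : x.1.1 ∈ D := by
            by_contra h
            exact h3 ⟨hxC, h⟩
          obtain ⟨s, hs⟩ := (hD.mem_iff _).1 hxD
          have hs' := hD.mono (Nat.le_succ s) hs
          refine ⟨s + 1, ?_⟩
          simp only [embedStep]
          rw [if_neg (by omega), if_neg h1, if_neg (by simp [h2]), hp0, if_pos hs']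
          split_ifs <;> exact Nat.succ_ne_zero _
      · intro k hk
        simp only [embedStep, cubeBit, hp0] at hk ⊢
        split_ifs at hk ⊢ with h1 h2 h3 h4 h5
        · exact absurd rfl hk
        · rfl
        · simp [h3]
        · have : x.1.1 ∈ A := hpA.2 ⟨k, h4⟩
          simp [h3, this]
        · have : x.1.1 ∉ A := fun h => h.2 ((hD.mem_iff _).2 ⟨k, h5⟩)
          simp [this]
        · exact absurd rfl hk
    · intro k n
      simp only [Nat.unpair_pair, i, bitCode]
      have : (0 : ℝ) < (1 / 2 : ℝ) ^ n := by positivity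
      split_ifs
      · rw [ratOfNat_one]
        simp
      · rw [ratOfNat_zero]
        simp
  · obtain ⟨c, hc⟩ := exists_code_of_primrec unembedStep primrec_unembedStep unembedStep_congr
    refine ⟨c, fun q y hq _ => ?_⟩
    generalize hx : y.2.choose = x
    have hxy : i x = y.1 := hx ▸ y.2.choose_spec
    have hbig : ∀ k, IsBig (q (Nat.pair k 2)) ↔ cubeBit A eC x.1.1 k := by
      intro k
      have h := hq k 2
      rw [← hxy] at h
      exact isBig_of_near h
    refine ⟨fun z => if z % 2 = 0 then x.1.1 else if cubeBit A eC x.1.1 z then 1 else 0,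
      fun z => ?_, x, hx.symm, ?_⟩
    · have heven : ∀ j, cubeBit A eC x.1.1 (2 * j) ↔ j = x.1.1 := by
        intro j
        simp [cubeBit]
      apply hc
      · by_cases hz : z % 2 = 0
        -- This prefix contains the deciding entry, and it is long enough for the bounded search to
        -- reach `n`, as `2 * n ≤ Nat.pair (2 * n) 2`.
        · refine ⟨Nat.pair (2 * x.1.1) 2 + 1, ?_⟩
          simp only [unembedStep, if_pos hz]
          rw [Ne, firstNonzero_eq_zero]
          intro h
          have h1 : 2 * x.1.1 ≤ Nat.pair (2 * x.1.1) 2 := Nat.left_le_pair _ _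
          have := h x.1.1 (by omega)
          rw [if_pos ⟨by omega, (hbig _).2 ((heven _).2 rfl)⟩] at this
          omega
        · refine ⟨Nat.pair z 2 + 1, ?_⟩
          simp only [unembedStep, if_neg hz, if_pos (Nat.lt_succ_self _)]
          split_ifs <;> omega
      · intro k hk
        by_cases hz : z % 2 = 0
        · simp only [unembedStep, if_pos hz] at hk ⊢
          obtain ⟨j, -, hj, -⟩ := (firstNonzero_eq hk).1 rfl
          rw [← hj] at hk ⊢
          split_ifs at hk ⊢ with h
          · rw [(heven j).1 ((hbig _).1 h.2)]
          · exact absurd rfl hk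
        · simp only [unembedStep, if_neg hz, hbig] at hk ⊢
          split_ifs at hk ⊢ <;> first | rfl | exact absurd rfl hk
    · refine names_spaceS.2 ⟨by simp, ?_⟩
      have hodd : ∀ k, cubeBit A eC x.1.1 (2 * k + 1) ↔ eC k x.1.1 = true ∧ x.1.1 ∈ A := by
        intro k
        have h1 : (2 * k + 1) % 2 ≠ 0 := by omega
        have h2 : (2 * k + 1) / 2 = k := by omega
        simp only [cubeBit, if_neg h1, h2]
      have h1 : ∀ k, (2 * k + 1) % 2 ≠ 0 := fun k => by omega
      simp only [if_neg (h1 _), hodd]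
      constructor
      · intro h
        obtain ⟨k, hk⟩ := (hC.mem_iff _).1 h.1
        exact ⟨k, by simp [hk, h]⟩
      · rintro ⟨k, hk⟩
        by_contra h
        simp [h] at hk

/-! Sets `A` for which `S_A` embeds into the Hilbert cube are 2-c.e. -/

/-- The sequence `0 … 0 1 1 1 …` with `t` zeros. -/
def delayed (t i : ℕ) : ℕ :=
  if i < t then 0 else 1

theorem exists_delayed_ne_zero (t : ℕ) : ∃ k, delayed t k ≠ 0 :=
  ⟨t, by simp [delayed]⟩

theorem delayed_eq {t i : ℕ} (h : i < t) : 0 = delayed t i := by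
  simp [delayed, h]

theorem primrec_delayed : Primrec₂ delayed :=
  Primrec.ite (Primrec.nat_lt.comp Primrec.snd Primrec.fst) (Primrec.const 0) (Primrec.const 1)

theorem primrec_nat_pow : Primrec₂ ((· ^ ·) : ℕ → ℕ → ℕ) :=
  Primrec₂.unpaired'.1 Nat.Primrec.pow

theorem pointSeq_delayed_congr (n : ℕ) {t i : ℕ} (h : i < t) :
    pointSeq n (fun _ => 0) i = pointSeq n (delayed t) i :=
  interleave_congr (fun _ _ => rfl) (fun _ hi => delayed_eq hi) i h

theorem names_pointSeq_delayed {A : Set ℕ} {n : ℕ} (hn : n ∈ A) (t : ℕ) :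
    (spaceS A).names (pointSeq n (delayed t)) (pointS A n) :=
  names_pointSeq.2 ⟨fun _ => exists_delayed_ne_zero t, fun _ => hn⟩

theorem names_pointSeq_zero {A : Set ℕ} {n : ℕ} (hn : n ∉ A) :
    (spaceS A).names (pointSeq n fun _ => 0) (pointS A n) :=
  names_pointSeq.2 ⟨fun h => absurd h hn, fun ⟨_, h⟩ => absurd rfl h⟩

/-- The distance of the rational numbers with numbers `a` and `b` is at least `3 / 4 * 2 ^ (-m)`. -/
def IsFar (m a b : ℕ) : Prop :=
  3 * ((a.unpair.2 + 1) * (b.unpair.2 + 1)) ≤ 4 * 2 ^ m *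
    (((a.unpair.1.unpair.1 * (b.unpair.2 + 1) + b.unpair.1.unpair.2 * (a.unpair.2 + 1)) -
      (a.unpair.1.unpair.2 * (b.unpair.2 + 1) + b.unpair.1.unpair.1 * (a.unpair.2 + 1))) +
    ((a.unpair.1.unpair.2 * (b.unpair.2 + 1) + b.unpair.1.unpair.1 * (a.unpair.2 + 1)) -
      (a.unpair.1.unpair.1 * (b.unpair.2 + 1) + b.unpair.1.unpair.2 * (a.unpair.2 + 1))))

/-- One of the two truncated differences vanishes. This lets `IsFar` speak of absolute values within
natural number arithmetic. -/
theorem cast_sub_add_sub (x y : ℕ) : (((x - y) + (y - x) : ℕ) : ℝ) = |(x : ℝ) - y| := by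
  rcases le_total x y with h | h
  · rw [Nat.sub_eq_zero_of_le h, zero_add, Nat.cast_sub h, abs_sub_comm, abs_of_nonneg]
    exact sub_nonneg.2 (Nat.cast_le.2 h)
  · rw [Nat.sub_eq_zero_of_le h, add_zero, Nat.cast_sub h, abs_of_nonneg]
    exact sub_nonneg.2 (Nat.cast_le.2 h)

theorem isFar_iff {m a b : ℕ} :
    IsFar m a b ↔ 3 * (1 / 2 : ℝ) ^ m ≤ 4 * |(ratOfNat a : ℝ) - ratOfNat b| := by
  unfold IsFar ratOfNat
  rw [← @Nat.cast_le ℝ]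
  generalize a.unpair.1.unpair.1 = a1, a.unpair.1.unpair.2 = a2, a.unpair.2 = a3,
    b.unpair.1.unpair.1 = b1, b.unpair.1.unpair.2 = b2, b.unpair.2 = b3
  rw [Nat.cast_mul (4 * 2 ^ m), cast_sub_add_sub]
  push_cast
  have ha : (0 : ℝ) < (a3 : ℝ) + 1 := by positivity
  have hb : (0 : ℝ) < (b3 : ℝ) + 1 := by positivity
  have h2 : (0 : ℝ) < 2 ^ m := by positivity
  have key : ((a1 : ℝ) - a2) / (a3 + 1) - ((b1 : ℝ) - b2) / (b3 + 1) =
      ((a1 : ℝ) * (b3 + 1) + b2 * (a3 + 1) - (a2 * (b3 + 1) + b1 * (a3 + 1))) /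
        ((a3 + 1) * (b3 + 1)) := by
    field_simp
    ring
  rw [key, abs_div, abs_of_pos (mul_pos ha hb), one_div, inv_pow, ← mul_div_assoc,
    ← div_eq_mul_inv, div_le_div_iff₀ h2 (mul_pos ha hb)]
  constructor <;> intro h <;> linarith

theorem primrec_isFar {α : Type*} [Primcodable α] {m a b : α → ℕ} (hm : Primrec m)
    (ha : Primrec a) (hb : Primrec b) : PrimrecPred fun x => IsFar (m x) (a x) (b x) := by
  have h1 : ∀ {f : α → ℕ}, Primrec f → Primrec fun x => (f x).unpair.1.unpair.1 := fun hf =>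
    Primrec.fst.comp (Primrec.unpair.comp (Primrec.fst.comp (Primrec.unpair.comp hf)))
  have h2 : ∀ {f : α → ℕ}, Primrec f → Primrec fun x => (f x).unpair.1.unpair.2 := fun hf =>
    Primrec.snd.comp (Primrec.unpair.comp (Primrec.fst.comp (Primrec.unpair.comp hf)))
  have h3 : ∀ {f : α → ℕ}, Primrec f → Primrec fun x => (f x).unpair.2 + 1 := fun hf =>
    Primrec.succ.comp (Primrec.snd.comp (Primrec.unpair.comp hf))
  have hX := Primrec.nat_add.comp (Primrec.nat_mul.comp (h1 ha) (h3 hb))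
    (Primrec.nat_mul.comp (h2 hb) (h3 ha))
  have hY := Primrec.nat_add.comp (Primrec.nat_mul.comp (h2 ha) (h3 hb))
    (Primrec.nat_mul.comp (h1 hb) (h3 ha))
  exact Primrec.nat_le.comp
    (Primrec.nat_mul.comp (Primrec.const 3) (Primrec.nat_mul.comp (h3 ha) (h3 hb)))
    (Primrec.nat_mul.comp
      (Primrec.nat_mul.comp (Primrec.const 4) (primrec_nat_pow.comp (Primrec.const 2) hm))
      (Primrec.nat_add.comp (Primrec.nat_sub.comp hX hY) (Primrec.nat_sub.comp hY hX)))

/-- The place in a name of a sequence of reals where the approximation with number `i` is improved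
by the factor `2 ^ d`. -/
def refinedIndex (d i : ℕ) : ℕ :=
  Nat.pair i.unpair.1 (i.unpair.2 + d)

theorem primrec_refinedIndex (d : ℕ) : Primrec (refinedIndex d) :=
  Primrec₂.natPair.comp (Primrec.fst.comp Primrec.unpair)
    (Primrec.nat_add.comp (Primrec.snd.comp Primrec.unpair) (Primrec.const d))

/-- The first `s` steps of the machine `c`, and `s'` steps of the machine `c'` on the refined
results, confirm the point over `n` at position `k`. -/
def Confirms (c c' : Code) (n s s' k : ℕ) : Prop :=
  (∀ i < s', run c (pointSeq n (delayed 0)) s (refinedIndex 1 i) ≠ 0) ∧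
    2 ≤ run c' (fun i => run c (pointSeq n (delayed 0)) s (refinedIndex 1 i) - 1) s' (2 * k + 1)

theorem primrec_confirms {α : Type*} [Primcodable α] (c c' : Code) {n s s' k : α → ℕ}
    (hn : Primrec n) (hs : Primrec s) (hs' : Primrec s') (hk : Primrec k) :
    PrimrecPred fun a => Confirms c c' (n a) (s a) (s' a) (k a) := by
  have h : Primrec₂ fun a i => run c (pointSeq (n a) (delayed 0)) (s a) (refinedIndex 1 i) := by
    refine primrec_run (c := fun _ : α × ℕ => c) (p := fun x => pointSeq (n x.1) (delayed 0))
      (s := fun x => s x.1) (n := fun x => refinedIndex 1 x.2) (Primrec.const c) ?_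
      (hs.comp Primrec.fst) ((primrec_refinedIndex 1).comp Primrec.snd)
    exact primrec_pointSeq (s := fun _ => delayed 0) (hn.comp Primrec.fst)
      (primrec_delayed.comp (Primrec.const 0) Primrec.snd)
  refine PrimrecPred.and (primrecPred_forall_lt (k := s')
    (R := fun a i => run c (pointSeq (n a) (delayed 0)) (s a) (refinedIndex 1 i) ≠ 0) ?_ hs') ?_
  · exact (Primrec.eq.comp h (Primrec.const 0)).not
  · refine Primrec.nat_le.comp (Primrec.const 2) (primrec_run (c := fun _ : α => c')
      (p := fun a i => run c (pointSeq (n a) (delayed 0)) (s a) (refinedIndex 1 i) - 1)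
      (Primrec.const c') ?_ hs' (Primrec.succ.comp (Primrec.nat_double.comp hk)))
    exact Primrec.pred.comp h

/-- `C` asks whether the inverse machine, run on the image of `⟨n, 1^ω⟩`, reports `⊤` after reading
finitely many approximations. `D` asks whether one of these approximations is also visibly away from
the image of some `⟨n, 0^t 1^ω⟩`. -/
theorem isTwoCE_of_computablyEmbeds {A : Set ℕ}
    (hA : ComputablyEmbeds (spaceS A) hilbertCube) : IsTwoCE A := by
  obtain ⟨f, ⟨c, hc⟩, g, hgf, c', hc'⟩ := hA
  have hc : ∀ p n, (spaceS A).names p (pointS A n) → ∃ q, Computes c p q ∧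
      ∀ e m, |(ratOfNat (q (Nat.pair e m)) : ℝ) - f (pointS A n) e| < (1 / 2 : ℝ) ^ m := by
    intro p n hp
    obtain ⟨q, hq, y, rfl, hy⟩ := hc p _ hp ⟨_, rfl⟩
    exact ⟨q, hq, hy⟩
  have hc' : ∀ q n, (∀ e m, |(ratOfNat (q (Nat.pair e m)) : ℝ) - f (pointS A n) e| <
      (1 / 2 : ℝ) ^ m) → ∃ r, Computes c' q r ∧ (spaceS A).names r (pointS A n) := by
    intro q n hq
    obtain ⟨r, hr, y, rfl, hy⟩ := hc' q ⟨f (pointS A n), Set.mem_range_self _⟩ hq ⟨_, rfl⟩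
    rw [hgf] at hy
    exact ⟨r, hr, hy⟩
  let Sep : ℕ → (ℕ × ℕ × ℕ) × (ℕ × ℕ) → Prop := fun n b =>
    Confirms c c' n b.1.1 b.1.2.1 b.1.2.2 ∧ ∃ i < b.1.2.1,
      run c (pointSeq n (delayed b.2.1)) b.2.2 (refinedIndex 2 i) ≠ 0 ∧
      IsFar i.unpair.2 (run c (pointSeq n (delayed 0)) b.1.1 (refinedIndex 1 i) - 1)
        (run c (pointSeq n (delayed b.2.1)) b.2.2 (refinedIndex 2 i) - 1)
  refine ⟨{n | ∃ b : ℕ × ℕ × ℕ, Confirms c c' n b.1 b.2.1 b.2.2}, {n | ∃ b, Sep n b}, ?_, ?_, ?_⟩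
  · refine rePred_exists (R := fun n (b : ℕ × ℕ × ℕ) => Confirms c c' n b.1 b.2.1 b.2.2) ?_
    exact primrec_confirms c c' Primrec.fst (Primrec.fst.comp Primrec.snd)
      (Primrec.fst.comp (Primrec.snd.comp Primrec.snd))
      (Primrec.snd.comp (Primrec.snd.comp Primrec.snd))
  · have h1 : Primrec fun x : ℕ × (ℕ × ℕ × ℕ) × (ℕ × ℕ) => x.2.1 := Primrec.fst.comp Primrec.snd
    have h2 : Primrec fun x : ℕ × (ℕ × ℕ × ℕ) × (ℕ × ℕ) => x.2.2 := Primrec.snd.comp Primrec.snd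
    have hs' := Primrec.fst.comp (Primrec.snd.comp h1)
    refine rePred_exists (R := Sep) (PrimrecPred.and ?_ ?_)
    · exact primrec_confirms c c' Primrec.fst (Primrec.fst.comp h1) hs'
        (Primrec.snd.comp (Primrec.snd.comp h1))
    have hrun : ∀ {t s : (ℕ × (ℕ × ℕ × ℕ) × (ℕ × ℕ)) × ℕ → ℕ} (d : ℕ), Primrec t → Primrec s →
        Primrec fun x : (ℕ × (ℕ × ℕ × ℕ) × (ℕ × ℕ)) × ℕ =>
          run c (pointSeq x.1.1 (delayed (t x))) (s x) (refinedIndex d x.2) := by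
      intro t s d ht hs
      refine primrec_run (c := fun _ : (ℕ × (ℕ × ℕ × ℕ) × (ℕ × ℕ)) × ℕ => c) (Primrec.const c)
        (primrec_pointSeq (n := fun x : (ℕ × (ℕ × ℕ × ℕ) × (ℕ × ℕ)) × ℕ => x.1.1)
          (s := fun x => delayed (t x)) (Primrec.fst.comp Primrec.fst) ?_) hs
        ((primrec_refinedIndex d).comp Primrec.snd)
      exact primrec_delayed.comp (ht.comp Primrec.fst) Primrec.snd
    have ht := (Primrec.fst.comp h2).comp (Primrec.fst (β := ℕ))
    have hv := (Primrec.snd.comp h2).comp (Primrec.fst (β := ℕ))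
    have hs := (Primrec.fst.comp h1).comp (Primrec.fst (β := ℕ))
    refine primrecPred_exists_lt (R := fun (x : ℕ × (ℕ × ℕ × ℕ) × (ℕ × ℕ)) i =>
      run c (pointSeq x.1 (delayed x.2.2.1)) x.2.2.2 (refinedIndex 2 i) ≠ 0 ∧
      IsFar i.unpair.2 (run c (pointSeq x.1 (delayed 0)) x.2.1.1 (refinedIndex 1 i) - 1)
        (run c (pointSeq x.1 (delayed x.2.2.1)) x.2.2.2 (refinedIndex 2 i) - 1)) ?_ hs'
    refine PrimrecPred.and (Primrec.eq.comp (hrun 2 ht hv) (Primrec.const 0)).not ?_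
    exact primrec_isFar (Primrec.snd.comp (Primrec.unpair.comp Primrec.snd))
      (Primrec.pred.comp (hrun 1 (Primrec.const 0) hs)) (Primrec.pred.comp (hrun 2 ht hv))
  · ext n
    constructor
    · intro hn
      refine ⟨?_, ?_⟩
      · obtain ⟨q, hq, hqf⟩ := hc _ n (names_pointSeq_delayed hn 0)
        -- Replacing each entry of a name by a more precise one gives a name again. The extra
        -- precision leaves the margin that makes the test in `Sep` sound.
        obtain ⟨r, hr, hrn⟩ := hc' (fun i => q (refinedIndex 1 i)) n fun e m => by
          simp only [refinedIndex, Nat.unpair_pair]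
          refine (hqf e (m + 1)).trans_le ?_
          exact pow_le_pow_of_le_one (by norm_num) (by norm_num) (Nat.le_succ m)
        obtain ⟨k, hk⟩ := (names_spaceS.1 hrn).2.1 hn
        obtain ⟨s', hs'⟩ := hr.exists_run (2 * k + 1)
        obtain ⟨s, hs⟩ := hq.exists_run_lt (refinedIndex 1) s'
        refine ⟨(s, s', k), fun i hi => ?_, ?_⟩
        · rw [hs i hi]
          exact Nat.succ_ne_zero _
        · dsimp only
          rw [run_congr (p' := fun i => q (refinedIndex 1 i)) fun i hi => by rw [hs i hi]; rfl, hs']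
          omega
      · rintro ⟨⟨⟨s, s', k⟩, t, v⟩, ⟨h1, -⟩, i, hi, h2, h3⟩
        obtain ⟨q, hq, hqf⟩ := hc _ n (names_pointSeq_delayed hn 0)
        obtain ⟨q', hq', hqf'⟩ := hc _ n (names_pointSeq_delayed hn t)
        dsimp only at h1 h2 h3 hi
        rw [hq.run_eq (h1 i hi), hq'.run_eq h2, isFar_iff] at h3
        simp only [Nat.add_sub_cancel] at h3
        -- Both sequences name the same point. With `m = i.unpair.2`, the errors `2^-(m+1)` and
        -- `2^-(m+2)` add up to `3/4 * 2^-m`, and both bounds are strict, so `IsFar` cannot hold.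
        have e1 := hqf i.unpair.1 (i.unpair.2 + 1)
        have e2 := hqf' i.unpair.1 (i.unpair.2 + 2)
        rw [pow_add] at e1 e2
        have e3 := abs_sub_le (ratOfNat (q (refinedIndex 1 i)) : ℝ) (f (pointS A n) i.unpair.1)
          (ratOfNat (q' (refinedIndex 2 i)))
        rw [abs_sub_comm (f (pointS A n) i.unpair.1 : ℝ)] at e3
        simp only [refinedIndex] at e3 h3
        linarith
    · rintro ⟨⟨⟨s, s', k⟩, h1, h2⟩, hD⟩
      by_contra hn
      obtain ⟨q, hq, hqf⟩ := hc _ n (names_pointSeq_zero hn)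
      dsimp only at h1 h2
      set Q := fun i => run c (pointSeq n (delayed 0)) s (refinedIndex 1 i) - 1 with hQ
      -- If all entries that were read were compatible with the image of the true point, they would
      -- extend to a name of it, and the inverse machine would report `⊤` for a point with value
      -- `⊥`.
      have hfar : ∃ i < s', (1 / 2 : ℝ) ^ i.unpair.2 ≤
          |(ratOfNat (Q i) : ℝ) - f (pointS A n) i.unpair.1| := by
        by_contra! hnear
        obtain ⟨r, hr, hrn⟩ := hc' (fun i => if i < s' then Q i else q i) n fun e m => by
          by_cases h : Nat.pair e m < s'
          · simpa [h] using hnear _ h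
          · simpa [h] using hqf e m
        rw [run_congr (p' := fun i => if i < s' then Q i else q i)
          fun i hi => (if_pos hi).symm] at h2
        rw [hr.run_eq (by omega)] at h2
        exact hn ((names_spaceS.1 hrn).2.2 ⟨k, by omega⟩)
      obtain ⟨i, hi, hfar⟩ := hfar
      obtain ⟨v, hv⟩ := hq.exists_run (refinedIndex 2 i)
      rw [run_congr fun j hj => pointSeq_delayed_congr n hj] at hv
      -- The number `v` serves both as step bound and as delay: `v` steps cannot distinguish `0^ω`
      -- from `0^v 1^ω`.
      refine hD ⟨((s, s', k), v, v), ⟨h1, h2⟩, i, hi, ?_, ?_⟩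
      · dsimp only
        rw [hv]
        exact Nat.succ_ne_zero _
      · dsimp only
        rw [hv, isFar_iff]
        simp only [Nat.add_sub_cancel]
        -- An entry off by at least `2^-m` is at distance at least `3/4 * 2^-m` from an
        -- approximation with error below `2^-(m+2)`.
        have e2 := hqf i.unpair.1 (i.unpair.2 + 2)
        rw [pow_add] at e2
        have e3 := abs_sub_le (ratOfNat (Q i) : ℝ) (ratOfNat (q (refinedIndex 2 i)))
          (f (pointS A n) i.unpair.1)
        simp only [refinedIndex, hQ] at e3 hfar ⊢
        linarith

/-! Open subsets of `S_A` -/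

/-- The first entry of a name already determines the point, so every characteristic function has a
continuous realiser, in general not a computable one. -/
theorem isOpenSet_spaceS {A : Set ℕ} (U : Set (setS A)) : IsOpenSet (spaceS A) U := by
  classical
  refine ⟨fun p _ => if pointS A (p 0) ∈ U then 1 else 0, ?_, fun p x hp => ?_⟩
  · have h : Continuous fun n : ℕ => fun _ : ℕ => if pointS A n ∈ U then 1 else 0 :=
      continuous_of_discreteTopology
    exact (h.comp (continuous_apply 0)).continuousOn
  · have hx : pointS A (p 0) = x := by
      rw [(names_spaceS.1 hp).1, ← eq_pointS]
    change (x ∈ U) = ∃ n, (if pointS A (p 0) ∈ U then 1 else 0) ≠ 0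
    rw [hx]
    by_cases h : x ∈ U <;> simp [h]

/-- The code `u` of an open set accepts the sequence `y` within `s` steps. -/
def Accepts (u y : ℕ → ℕ) (s : ℕ) : Prop :=
  ∃ i < s, 2 ≤ run (Denumerable.ofNat Code (u 0)) (interleave (fun n => u (n + 1)) y) s i

/-- The bound on `u` is `s + 1` because `u 0` is the machine index and the oracle starts at `u 1`.
-/
theorem accepts_congr {u u' y y' : ℕ → ℕ} {s : ℕ} (hu : ∀ i < s + 1, u i = u' i)
    (hy : ∀ i < s, y i = y' i) : Accepts u y s ↔ Accepts u' y' s := by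
  unfold Accepts
  rw [hu 0 (by omega)]
  simp only [run_congr (interleave_congr (fun i hi => hu (i + 1) (by omega)) hy)]

/-- In `Accepts`, a result of at least `2` stands for a nonzero output symbol, which is what makes a
Sierpinski name one of `⊤`. -/
theorem mem_iff_accepts {X : Type*} {rX : BaireRep X} {U : {U : Set X // IsOpenSet rX U}}
    {u y : ℕ → ℕ} {x : X} (hu : rX.opens.names u U) (hy : rX.names y x) :
    x ∈ U.1 ↔ ∃ s, Accepts u y s := by
  obtain ⟨r, hr, hrx⟩ := hu y x hy
  have hrx : x ∈ U.1 ↔ ∃ k, r k ≠ 0 := iff_of_eq hrx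
  rw [hrx]
  constructor
  · rintro ⟨k, hk⟩
    obtain ⟨s, hs⟩ := Computes.exists_run hr k
    refine ⟨max s (k + 1), k, by omega, ?_⟩
    rw [run_mono (le_max_left _ _) (by rw [hs]; omega), hs]
    omega
  · rintro ⟨s, k, -, hk⟩
    rw [Computes.run_eq hr (by omega)] at hk
    exact ⟨k, by omega⟩

theorem primrec_accepts {α : Type*} [Primcodable α] {u y : α → ℕ → ℕ} {s : α → ℕ}
    (hu : Primrec₂ u) (hy : Primrec₂ y) (hs : Primrec s) :
    PrimrecPred fun a => Accepts (u a) (y a) (s a) := by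
  refine primrecPred_exists_lt (R := fun a i => 2 ≤ run (Denumerable.ofNat Code (u a 0))
    (interleave (fun n => u a (n + 1)) (y a)) (s a) i) ?_ hs
  refine Primrec.nat_le.comp (Primrec.const 2) (primrec_run
    (c := fun x : α × ℕ => Denumerable.ofNat Code (u x.1 0))
    (p := fun x => interleave (fun n => u x.1 (n + 1)) (y x.1)) ?_ ?_ (hs.comp Primrec.fst)
    Primrec.snd)
  · exact (Primrec.ofNat Code).comp (hu.comp Primrec.fst (Primrec.const 0))
  · refine primrec_interleave (p := fun (x : α × ℕ) n => u x.1 (n + 1)) (q := fun x => y x.1) ?_ ?_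
    · exact hu.comp (Primrec.fst.comp Primrec.fst) (Primrec.succ.comp Primrec.snd)
    · exact hy.comp (Primrec.fst.comp Primrec.fst) Primrec.snd

/-- The code of an open set that is extracted with `h` from the results of `s` steps of the
machine `c` on `p` accepts the sequence `y` within `s'` steps. -/
def ResultAccepts (c : Code) (h : ℕ → ℕ) (p y : ℕ → ℕ) (s s' : ℕ) : Prop :=
  (∀ i < s' + 1, run c p s (h i) ≠ 0) ∧ Accepts (fun i => run c p s (h i) - 1) y s'

theorem resultAccepts_congr {c : Code} {h p p' y y' : ℕ → ℕ} {s s' : ℕ}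
    (hp : ∀ i < s, p i = p' i) (hy : ∀ i < s', y i = y' i) :
    ResultAccepts c h p y s s' ↔ ResultAccepts c h p' y' s s' := by
  unfold ResultAccepts
  simp only [run_congr hp, accepts_congr (fun _ _ => rfl) hy]

theorem Computes.exists_resultAccepts_iff {c : Code} {h p q y : ℕ → ℕ} (hq : Computes c p q) :
    (∃ s s', ResultAccepts c h p y s s') ↔ ∃ s, Accepts (fun i => q (h i)) y s := by
  constructor
  · rintro ⟨s, s', h1, h2⟩
    refine ⟨s', (accepts_congr (fun i hi => ?_) fun _ _ => rfl).1 h2⟩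
    rw [hq.run_eq (h1 i hi)]
    rfl
  · rintro ⟨s', h2⟩
    obtain ⟨s, hs⟩ := hq.exists_run_lt h (s' + 1)
    refine ⟨s, s', fun i hi => ?_, (accepts_congr (fun i hi => ?_) fun _ _ => rfl).1 h2⟩
    · rw [hs i hi]
      exact Nat.succ_ne_zero _
    · rw [hs i hi]
      rfl

theorem primrec_resultAccepts {α : Type*} [Primcodable α] (c : Code) {h : ℕ → ℕ}
    {p y : α → ℕ → ℕ} {s s' : α → ℕ} (hh : Primrec h) (hp : Primrec₂ p) (hy : Primrec₂ y)
    (hs : Primrec s) (hs' : Primrec s') :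
    PrimrecPred fun a => ResultAccepts c h (p a) (y a) (s a) (s' a) := by
  have hr : Primrec₂ fun a i => run c (p a) (s a) (h i) :=
    primrec_run (c := fun _ : α × ℕ => c) (p := fun x => p x.1) (Primrec.const c)
      (hp.comp (Primrec.fst.comp Primrec.fst) Primrec.snd) (hs.comp Primrec.fst)
      (hh.comp Primrec.snd)
  refine PrimrecPred.and (primrecPred_forall_lt (k := fun a => s' a + 1)
    (R := fun a i => run c (p a) (s a) (h i) ≠ 0) (Primrec.eq.comp hr (Primrec.const 0)).not
    (Primrec.succ.comp hs')) ?_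
  exact primrec_accepts (u := fun a i => run c (p a) (s a) (h i) - 1) (Primrec.pred.comp hr) hy hs'

/-! Sets `A` for which `S_A` is computably normal are 2-c.e. -/

/-- The sequence `a, p 0, p 1, …`. -/
def consSeq (a : ℕ) (p : ℕ → ℕ) (i : ℕ) : ℕ :=
  if i = 0 then a else p (i - 1)

theorem consSeq_succ (a : ℕ) (p : ℕ → ℕ) (i : ℕ) : consSeq a p (i + 1) = p i := rfl

theorem consSeq_congr (a : ℕ) {p p' : ℕ → ℕ} {k : ℕ} (h : ∀ i < k, p i = p' i) :
    ∀ i < k, consSeq a p i = consSeq a p' i := by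
  intro i hi
  unfold consSeq
  rw [h (i - 1) (by omega)]

theorem primrec_consSeq {α : Type*} [Primcodable α] {a : α → ℕ} {p : α → ℕ → ℕ}
    (ha : Primrec a) (hp : Primrec₂ p) : Primrec₂ fun x => consSeq (a x) (p x) :=
  Primrec.ite (Primrec.eq.comp Primrec.snd (Primrec.const 0)) (ha.comp Primrec.fst)
    (hp.comp Primrec.fst (Primrec.pred.comp Primrec.snd))

/-- On an oracle `n, b 0, b 1, …` interleaved with a name `q`, entry `0` is `n` and entry `1` is `q
0`. The choice of `j` then scans either the truth value part of `q` or the sequence `b`, so the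
machine accepts points off `n`, and the point over `n` once a nonzero symbol is seen. -/
theorem exists_code_avoid_or {j : ℕ → ℕ} (hj : Primrec j) (hpos : ∀ k, 1 ≤ j k) :
    ∃ c : Code, ∀ p, Computes c p fun k => if p 1 ≠ p 0 ∨ p (j k) ≠ 0 then 1 else 0 := by
  obtain ⟨c, hc⟩ := exists_code_of_primrec (fun p k z =>
    if k ≤ j z then 0 else if p 1 ≠ p 0 ∨ p (j z) ≠ 0 then 2 else 1) (by
      have hz : Primrec fun a : List ℕ × ℕ => j a.2 := hj.comp Primrec.snd
      have hp : ∀ {f : List ℕ × ℕ → ℕ}, Primrec f →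
          Primrec fun a : List ℕ × ℕ => a.1.getD (f a) 0 :=
        fun hf => (Primrec.list_getD 0).comp Primrec.fst hf
      refine Primrec.ite (Primrec.nat_le.comp (Primrec.list_length.comp Primrec.fst) hz)
        (Primrec.const 0) (Primrec.ite (PrimrecPred.or ?_ ?_) (Primrec.const 2) (Primrec.const 1))
      · exact (Primrec.eq.comp (hp (Primrec.const 1)) (hp (Primrec.const 0))).not
      · exact (Primrec.eq.comp (hp hz) (Primrec.const 0)).not) (by
      intro p p' k z h
      by_cases hk : k ≤ j z
      · simp [hk]
      · have := hpos z
        simp only [hk, if_false, h 0 (by omega), h 1 (by omega), h (j z) (by omega)])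
  refine ⟨c, fun p z => hc p z _ ⟨j z + 1, ?_⟩ fun k hk => ?_⟩
  · rw [if_neg (by omega)]
    split_ifs <;> omega
  · by_cases h : k ≤ j z
    · exact absurd (if_pos h) hk
    · rw [if_neg h]
      dsimp only
      split_ifs <;> rfl

/-- The code of an open set that is given by the machine `c` with the oracle `n, b 0, b 1, …`. -/
def oracleName (c : Code) (n : ℕ) (b : ℕ → ℕ) : ℕ → ℕ :=
  consSeq (Encodable.encode c) (consSeq n b)

theorem oracleName_congr (c : Code) (n : ℕ) {b b' : ℕ → ℕ} {k : ℕ} (h : ∀ i < k, b i = b' i) :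
    ∀ i < k, oracleName c n b i = oracleName c n b' i :=
  consSeq_congr _ (consSeq_congr _ h)

theorem primrec_oracleName {α : Type*} [Primcodable α] (c : Code) {n : α → ℕ} {b : α → ℕ → ℕ}
    (hn : Primrec n) (hb : Primrec₂ b) : Primrec₂ fun a => oracleName c (n a) (b a) :=
  primrec_consSeq (Primrec.const _) (primrec_consSeq hn hb)

theorem codedComputes_consSeq {c : Code} {p q r : ℕ → ℕ}
    (h : Computes c (interleave p q) r) : CodedComputes (consSeq (Encodable.encode c) p) q r := by
  change Computes (Denumerable.ofNat Code (Encodable.encode c)) (interleave p q) r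
  rwa [Denumerable.ofNat_encode]

/-- The closed set `F` is the point over `n` if `n ∉ A` and empty otherwise; `G` is that point if `b
= 0^ω` and empty otherwise. Names of both are computable from `n` and `b` without knowing `A`, and
the sets are disjoint exactly if `n ∈ A` or `b ≠ 0^ω`. -/
theorem isTwoCE_of_isComputablyNormal {A : Set ℕ}
    (hA : IsComputablyNormal (spaceS A)) : IsTwoCE A := by
  obtain ⟨hdom, c, hc⟩ := hA
  obtain ⟨cF, hF⟩ := exists_code_avoid_or (j := fun k => 2 * (2 * k + 1) + 1)
    (Primrec.nat_double_succ.comp Primrec.nat_double_succ) (fun k => by omega)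
  obtain ⟨cG, hG⟩ := exists_code_avoid_or (j := fun k => 2 * (k + 1))
    (Primrec.nat_double.comp Primrec.succ) (fun k => by omega)
  have h0 : ∀ n b q, interleave (consSeq n b) q 0 = n := fun n b q => rfl
  have h1 : ∀ n b q, interleave (consSeq n b) q 1 = q 0 := fun n b q => rfl
  let P : ℕ → (ℕ → ℕ) → ℕ → ℕ := fun n b => interleave (oracleName cF n b) (oracleName cG n b)
  have hP : ∀ n b, (n ∈ A ∨ ∃ k, b k ≠ 0) → ∃ q, Computes c (P n b) q ∧
      ∃ U V : Set (setS A), Disjoint U V ∧ (n ∉ A → pointS A n ∈ U) ∧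
        ((∀ k, b k = 0) → pointS A n ∈ V) ∧ ∀ y x, (spaceS A).names y x →
          (x ∈ U ↔ ∃ s, Accepts (fun i => q (2 * i)) y s) ∧
          (x ∈ V ↔ ∃ s, Accepts (fun i => q (2 * i + 1)) y s) := by
    intro n b hnb
    let F : {B : Set (setS A) // IsClosedSet (spaceS A) B} :=
      ⟨{x | x.1.1 = n ∧ n ∉ A}, isOpenSet_spaceS _⟩
    let G : {B : Set (setS A) // IsClosedSet (spaceS A) B} :=
      ⟨{x | x.1.1 = n ∧ ∀ k, b k = 0}, isOpenSet_spaceS _⟩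
    have hFn : (spaceS A).closeds.names (oracleName cF n b) F := by
      intro q x hq
      refine ⟨_, codedComputes_consSeq (hF _), ?_⟩
      change (x ∈ F.1ᶜ) = ∃ k, _ ≠ 0
      obtain ⟨hq0, hqA⟩ := names_spaceS.1 hq
      simp only [h0, h1, interleave_odd, hq0, F]
      by_cases hx : x.1.1 = n
      · simp only [hx] at hqA
        simp [hx, hqA]
      · simp [hx]
    have hGn : (spaceS A).closeds.names (oracleName cG n b) G := by
      intro q x hq
      refine ⟨_, codedComputes_consSeq (hG _), ?_⟩
      change (x ∈ G.1ᶜ) = ∃ k, _ ≠ 0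
      obtain ⟨hq0, hqA⟩ := names_spaceS.1 hq
      simp only [h0, h1, interleave_even, consSeq_succ, hq0, G]
      by_cases hx : x.1.1 = n
      · simp [hx]
      · simp [hx]
    have hdisj : Disjoint F.1 G.1 := by
      rw [Set.disjoint_left]
      rintro x ⟨-, hx⟩ ⟨-, hx'⟩
      rcases hnb with h | ⟨k, hk⟩
      · exact hx h
      · exact hk (hx' k)
    have hmem : (F, G) ∈ (normMap (spaceS A)).dom := by
      rw [hdom]
      exact hdisj
    obtain ⟨q, hq, ⟨U, V⟩, ⟨hUV, hFU, hGV⟩, hU, hV⟩ := hc (P n b) (F, G) (by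
      refine ⟨?_, ?_⟩
      · simpa only [P, interleave_even] using hFn
      · simpa only [P, interleave_odd] using hGn) hmem
    exact ⟨q, hq, U.1, V.1, hUV, fun h => hFU ⟨rfl, h⟩, fun h => hGV ⟨rfl, h⟩, fun y x hy =>
      ⟨mem_iff_accepts hU hy, mem_iff_accepts hV hy⟩⟩
  have hPc : ∀ n s, ∀ i < s, P n (fun _ => 0) i = P n (delayed s) i := fun n s =>
    interleave_congr (oracleName_congr _ _ fun _ hi => delayed_eq hi)
      (oracleName_congr _ _ fun _ hi => delayed_eq hi)
  -- `Acc` says that the computed `V` accepts `⟨n, 1^ω⟩`. `Sep` says that, for `b = 0^t 1^ω`,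
  -- moreover the computed `U` accepts some `⟨n, 0^j 1^ω⟩`; for `n ∈ A` this would contradict
  -- disjointness.
  let Acc : ℕ → (ℕ → ℕ) → ℕ × ℕ → Prop := fun n b v =>
    ResultAccepts c (fun i => 2 * i + 1) (P n b) (pointSeq n (delayed 0)) v.1 v.2
  let Sep : ℕ → (ℕ × ℕ) × (ℕ × ℕ) × (ℕ × ℕ) → Prop := fun n v =>
    Acc n (delayed v.1.1) v.2.1 ∧ ResultAccepts c (fun i => 2 * i) (P n (delayed v.1.1))
      (pointSeq n (delayed v.1.2)) v.2.2.1 v.2.2.2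
  have hPr : ∀ {β : Type} [Primcodable β] {n : β → ℕ} {b : β → ℕ → ℕ}, Primrec n → Primrec₂ b →
      Primrec₂ fun x => P (n x) (b x) := fun hn hb =>
    primrec_interleave (primrec_oracleName _ hn hb) (primrec_oracleName _ hn hb)
  have hdel : ∀ {β : Type} [Primcodable β] {t : β → ℕ}, Primrec t →
      Primrec₂ fun x => delayed (t x) := fun ht =>
    primrec_delayed.comp (ht.comp Primrec.fst) Primrec.snd
  refine ⟨{n | ∃ v, Acc n (fun _ => 0) v}, {n | ∃ v, Sep n v}, ?_, ?_, ?_⟩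
  · refine rePred_exists (R := fun n v => Acc n (fun _ => 0) v) ?_
    exact primrec_resultAccepts c Primrec.nat_double_succ
      (hPr (n := fun x : ℕ × ℕ × ℕ => x.1) (b := fun _ _ => 0) Primrec.fst (Primrec.const 0).to₂)
      (primrec_pointSeq Primrec.fst (hdel (t := fun _ => 0) (Primrec.const 0)))
      (Primrec.fst.comp Primrec.snd) (Primrec.snd.comp Primrec.snd)
  · have h2 : Primrec fun x : ℕ × (ℕ × ℕ) × (ℕ × ℕ) × (ℕ × ℕ) => x.2.1 :=
      Primrec.fst.comp Primrec.snd
    have h3 : Primrec fun x : ℕ × (ℕ × ℕ) × (ℕ × ℕ) × (ℕ × ℕ) => x.2.2.1 :=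
      Primrec.fst.comp (Primrec.snd.comp Primrec.snd)
    have h4 : Primrec fun x : ℕ × (ℕ × ℕ) × (ℕ × ℕ) × (ℕ × ℕ) => x.2.2.2 :=
      Primrec.snd.comp (Primrec.snd.comp Primrec.snd)
    have hp := hPr (n := fun x : ℕ × (ℕ × ℕ) × (ℕ × ℕ) × (ℕ × ℕ) => x.1) Primrec.fst
      (hdel (Primrec.fst.comp h2))
    refine rePred_exists (R := Sep) (PrimrecPred.and ?_ ?_)
    · exact primrec_resultAccepts c Primrec.nat_double_succ hp
        (primrec_pointSeq Primrec.fst (hdel (t := fun _ => 0) (Primrec.const 0)))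
        (Primrec.fst.comp h3) (Primrec.snd.comp h3)
    · exact primrec_resultAccepts c Primrec.nat_double hp
        (primrec_pointSeq Primrec.fst (hdel (Primrec.snd.comp h2)))
        (Primrec.fst.comp h4) (Primrec.snd.comp h4)
  · ext n
    constructor
    · intro hn
      refine ⟨?_, ?_⟩
      · obtain ⟨q, hq, U, V, -, -, hV, hmem⟩ := hP n (fun _ => 0) (Or.inl hn)
        obtain ⟨s, s', h⟩ := hq.exists_resultAccepts_iff.2
          ((hmem _ _ (names_pointSeq_delayed hn 0)).2.1 (hV fun _ => rfl))
        exact ⟨(s, s'), h⟩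
      · rintro ⟨⟨⟨t, j⟩, ⟨s, s'⟩, v, v'⟩, h1, h2⟩
        obtain ⟨q, hq, U, V, hUV, -, -, hmem⟩ := hP n (delayed t) (Or.inl hn)
        exact Set.disjoint_left.1 hUV
          ((hmem _ _ (names_pointSeq_delayed hn j)).1.2 (hq.exists_resultAccepts_iff.1 ⟨v, v', h2⟩))
          ((hmem _ _ (names_pointSeq_delayed hn 0)).2.2 (hq.exists_resultAccepts_iff.1 ⟨s, s', h1⟩))
    · rintro ⟨⟨⟨s, s'⟩, hC⟩, hD⟩
      by_contra hn
      -- For `n ∉ A` the input with `b = 0^ω` is not a disjoint pair, but delaying `b` by the `s`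
      -- steps of the run makes it one without changing that run. Now `U` must contain the point
      -- over `n`.
      obtain ⟨q, hq, U, V, -, hU, -, hmem⟩ := hP n (delayed s) (Or.inr (exists_delayed_ne_zero s))
      obtain ⟨v, v', h⟩ := hq.exists_resultAccepts_iff.2
        ((hmem _ _ (names_pointSeq_zero hn)).1.1 (hU hn))
      exact hD ⟨((s, v'), (s, s'), v, v'),
        (resultAccepts_congr (hPc n s) fun _ _ => rfl).1 hC,
        (resultAccepts_congr (fun _ _ => rfl) fun _ hi => pointSeq_delayed_congr n hi).1 h⟩

/-! Computable normality of `S_A` for 2-c.e. sets `A` -/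

open Classical in
/-- Which of the codes `g`, `f` of open sets accepts `⟨n n n …, b⟩` within `t` steps:
`1` for `g`, otherwise `2` for `f`, and `0` for none. -/
noncomputable def acceptor (f g b : ℕ → ℕ) (n t : ℕ) : ℕ :=
  if Accepts g (pointSeq n b) t then 1 else if Accepts f (pointSeq n b) t then 2 else 0

theorem acceptor_congr {f f' g g' b b' : ℕ → ℕ} {n t : ℕ} (hf : ∀ i < t + 1, f i = f' i)
    (hg : ∀ i < t + 1, g i = g' i) (hb : ∀ i < t, pointSeq n b i = pointSeq n b' i) :
    acceptor f g b n t = acceptor f' g' b' n t := by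
  have h1 : Accepts f (pointSeq n b) t ↔ Accepts f' (pointSeq n b') t := accepts_congr hf hb
  have h2 : Accepts g (pointSeq n b) t ↔ Accepts g' (pointSeq n b') t := accepts_congr hg hb
  classical
  exact if_congr h2 rfl (if_congr h1 rfl rfl)

theorem primrec_acceptor {α : Type*} [Primcodable α] {f g b : α → ℕ → ℕ} {n t : α → ℕ}
    (hf : Primrec₂ f) (hg : Primrec₂ g) (hb : Primrec₂ b) (hn : Primrec n) (ht : Primrec t) :
    Primrec fun a => acceptor (f a) (g a) (b a) (n a) (t a) := by
  classical
  have hp := primrec_pointSeq hn hb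
  exact Primrec.ite (primrec_accepts hg hp ht) (Primrec.const 1)
    (Primrec.ite (primrec_accepts hf hp ht) (Primrec.const 2) (Primrec.const 0))

/-- The decision after `k` steps for the point with name `y`. The results for the sequence
`⟨n n n …, 0 0 0 …⟩` count if they are found before `n` is enumerated into `C`, or if
`n ∉ A` is known; otherwise those for `⟨n n n …, 1 1 1 …⟩` count when `n ∈ A` is known. -/
noncomputable def verdict (eC eD : ℕ → ℕ → Bool) (f g y : ℕ → ℕ) (k : ℕ) : ℕ :=
  if firstNonzero (fun t => if eC t (y 0) = false ∨ eD k (y 0) = true then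
      acceptor f g (fun _ => 0) (y 0) t else 0) k = 0 then
    if eC k (y 0) = true ∧ ∃ i < k, i % 2 = 1 ∧ y i ≠ 0 then
      firstNonzero (acceptor f g (delayed 0) (y 0)) k
    else 0
  else firstNonzero (fun t => if eC t (y 0) = false ∨ eD k (y 0) = true then
      acceptor f g (fun _ => 0) (y 0) t else 0) k

theorem verdict_congr {eC eD : ℕ → ℕ → Bool} {f f' g g' y y' : ℕ → ℕ} {k : ℕ}
    (hf : ∀ i < k + 1, f i = f' i) (hg : ∀ i < k + 1, g i = g' i)
    (hy : ∀ i < k + 1, y i = y' i) : verdict eC eD f g y k = verdict eC eD f' g' y' k := by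
  have hacc : ∀ b n, ∀ t < k, acceptor f g b n t = acceptor f' g' b n t := fun b n t ht =>
    acceptor_congr (fun i hi => hf i (by omega)) (fun i hi => hg i (by omega)) fun _ _ => rfl
  have h1 : firstNonzero (fun t => if eC t (y 0) = false ∨ eD k (y 0) = true then
      acceptor f g (fun _ => 0) (y 0) t else 0) k =
      firstNonzero (fun t => if eC t (y' 0) = false ∨ eD k (y' 0) = true then
      acceptor f' g' (fun _ => 0) (y' 0) t else 0) k := by
    refine firstNonzero_congr fun t ht => ?_
    rw [hacc _ _ t ht, hy 0 (by omega)]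
  have h2 : firstNonzero (acceptor f g (delayed 0) (y 0)) k =
      firstNonzero (acceptor f' g' (delayed 0) (y' 0)) k := by
    refine firstNonzero_congr fun t ht => ?_
    rw [hacc _ _ t ht, hy 0 (by omega)]
  have h3 : (∃ i < k, i % 2 = 1 ∧ y i ≠ 0) ↔ ∃ i < k, i % 2 = 1 ∧ y' i ≠ 0 :=
    exists_congr fun i => and_congr_right fun hi => by rw [hy i (by omega)]
  unfold verdict
  rw [h1, h2]
  simp only [h3, hy 0 (by omega)]

theorem primrec_verdict {α : Type*} [Primcodable α] {eC eD : ℕ → ℕ → Bool} (hC : Primrec₂ eC)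
    (hD : Primrec₂ eD) {f g y : α → ℕ → ℕ} {k : α → ℕ} (hf : Primrec₂ f) (hg : Primrec₂ g)
    (hy : Primrec₂ y) (hk : Primrec k) :
    Primrec fun a => verdict eC eD (f a) (g a) (y a) (k a) := by
  have h0 : Primrec fun a => y a 0 := hy.comp Primrec.id (Primrec.const 0)
  have hacc : ∀ {b : ℕ → ℕ}, Primrec b →
      Primrec₂ fun a t => acceptor (f a) (g a) b (y a 0) t := fun hb =>
    primrec_acceptor (f := fun x : α × ℕ => f x.1) (g := fun x => g x.1) (b := fun _ => _)
      (hf.comp (Primrec.fst.comp Primrec.fst) Primrec.snd)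
      (hg.comp (Primrec.fst.comp Primrec.fst) Primrec.snd) (hb.comp Primrec.snd)
      (h0.comp Primrec.fst) Primrec.snd
  have h1 : Primrec fun a => firstNonzero
      (fun t => if eC t (y a 0) = false ∨ eD (k a) (y a 0) = true then
        acceptor (f a) (g a) (fun _ => 0) (y a 0) t else 0) (k a) := by
    refine primrec_firstNonzero (f := fun a t =>
      if eC t (y a 0) = false ∨ eD (k a) (y a 0) = true then
        acceptor (f a) (g a) (fun _ => 0) (y a 0) t else 0) ?_ hk
    refine Primrec.ite (PrimrecPred.or ?_ ?_) (hacc (Primrec.const 0)) (Primrec.const 0)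
    · exact Primrec.eq.comp (hC.comp Primrec.snd (h0.comp Primrec.fst)) (Primrec.const false)
    · exact Primrec.eq.comp (hD.comp (hk.comp Primrec.fst) (h0.comp Primrec.fst))
        (Primrec.const true)
  refine Primrec.ite (Primrec.eq.comp h1 (Primrec.const 0)) (Primrec.ite (PrimrecPred.and ?_ ?_)
    (primrec_firstNonzero (hacc (primrec_delayed.comp (Primrec.const 0) Primrec.id)) hk)
    (Primrec.const 0)) h1
  · exact Primrec.eq.comp (hC.comp hk h0) (Primrec.const true)
  · refine primrecPred_exists_lt (R := fun a i => i % 2 = 1 ∧ y a i ≠ 0) ?_ hk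
    exact (Primrec.eq.comp (Primrec.nat_mod.comp Primrec.snd (Primrec.const 2))
      (Primrec.const 1)).and (Primrec.eq.comp (hy.comp Primrec.fst Primrec.snd)
        (Primrec.const 0)).not

theorem exists_code_verdict {eC eD : ℕ → ℕ → Bool} (hC : Primrec₂ eC) (hD : Primrec₂ eD)
    (w : ℕ) : ∃ c : Code, ∀ p y, Computes c (interleave p y) fun k =>
      if verdict eC eD (fun i => p (2 * i)) (fun i => p (2 * i + 1)) y k = w then 1 else 0 := by
  -- Stage `z` of the verdict uses entries up to `z` of its three sequences, the last of which sits
  -- at position `2 * (2 * z + 1)`.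
  obtain ⟨c, hc⟩ := exists_code_of_primrec (fun x k z => if k ≤ 4 * z + 4 then 0 else
    if verdict eC eD (fun i => x (2 * (2 * i))) (fun i => x (2 * (2 * i + 1)))
      (fun i => x (2 * i + 1)) z = w then 2 else 1) (by
      have hx : ∀ {h : ℕ → ℕ}, Primrec h →
          Primrec₂ fun (a : List ℕ × ℕ) i => a.1.getD (h i) 0 := fun hh =>
        (Primrec.list_getD 0).comp (Primrec.fst.comp Primrec.fst) (hh.comp Primrec.snd)
      refine Primrec.ite (Primrec.nat_le.comp (Primrec.list_length.comp Primrec.fst)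
        (Primrec.nat_add.comp (Primrec.nat_mul.comp (Primrec.const 4) Primrec.snd)
          (Primrec.const 4))) (Primrec.const 0) (Primrec.ite (Primrec.eq.comp ?_
            (Primrec.const w)) (Primrec.const 2) (Primrec.const 1))
      exact primrec_verdict hC hD (hx (Primrec.nat_double.comp Primrec.nat_double))
        (hx (Primrec.nat_double.comp Primrec.nat_double_succ)) (hx Primrec.nat_double_succ)
        Primrec.snd) (by
      intro x x' k z h
      by_cases hk : k ≤ 4 * z + 4
      · simp only [hk, if_true]
      · rw [verdict_congr (fun i hi => h _ (by omega)) (fun i hi => h _ (by omega))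
          fun i hi => h _ (by omega)])
  refine ⟨c, fun p y z => hc _ z _ ⟨4 * z + 5, ?_⟩ fun k hk => ?_⟩
  · rw [if_neg (by omega)]
    split_ifs <;> omega
  · by_cases h : k ≤ 4 * z + 4
    · exact absurd (if_pos h) hk
    · rw [if_neg h]
      simp only [interleave_even, interleave_odd]
      split_ifs <;> rfl

/-- Since a code of a function is a machine index followed by an oracle, names for `U` and `V` arise
by putting fixed indices in front of the name of the input pair. -/
theorem exists_code_consSeq (a b : ℕ) : ∃ c : Code, ∀ p,
    Computes c p (interleave (consSeq a p) (consSeq b p)) := by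
  obtain ⟨c, hc⟩ := exists_code_of_primrec (fun p k z => if k ≤ z then 0 else
    interleave (consSeq a p) (consSeq b p) z + 1) (by
      have hp : Primrec₂ fun (x : List ℕ × ℕ) i => x.1.getD i 0 :=
        (Primrec.list_getD 0).comp (Primrec.fst.comp Primrec.fst) Primrec.snd
      refine Primrec.ite (Primrec.nat_le.comp (Primrec.list_length.comp Primrec.fst) Primrec.snd)
        (Primrec.const 0) (Primrec.succ.comp ?_)
      exact (primrec_interleave (primrec_consSeq (Primrec.const a) hp)
        (primrec_consSeq (Primrec.const b) hp)).comp Primrec.id Primrec.snd) (by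
      intro p p' k z h
      by_cases hk : k ≤ z
      · simp only [hk, if_true]
      · rw [interleave_congr (consSeq_congr a h) (consSeq_congr b h) z (by omega)])
  refine ⟨c, fun p z => hc p z _ ⟨z + 1, ?_⟩ fun k hk => ?_⟩
  · rw [if_neg (by omega)]
    exact Nat.succ_ne_zero _
  · by_cases h : k ≤ z
    · exact absurd (if_pos h) hk
    · rw [if_neg h]

/-- All names of the point over `n` lead to one value `v`, and `v` comes from a run on `⟨n, 0^ω⟩`,
or on `⟨n, 1^ω⟩` with `n ∈ A`. The uniqueness makes the two open sets disjoint; the origin of `v`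
makes them cover the closed sets. -/
theorem exists_verdict {C D : Set ℕ} {eC eD : ℕ → ℕ → Bool} (hC : IsEnumeration C eC)
    (hD : IsEnumeration D eD) {f g : ℕ → ℕ} {n : ℕ}
    (h0 : n ∉ C \ D → ∃ t, acceptor f g (fun _ => 0) n t ≠ 0)
    (h1 : n ∈ C \ D → ∃ t, acceptor f g (delayed 0) n t ≠ 0) :
    ∃ v, ((∃ t, acceptor f g (fun _ => 0) n t = v) ∨
        n ∈ C \ D ∧ ∃ t, acceptor f g (delayed 0) n t = v) ∧
      v ≠ 0 ∧ ∀ y, y 0 = n → (n ∈ C \ D ↔ ∃ k, y (2 * k + 1) ≠ 0) →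
        (∃ k, verdict eC eD f g y k ≠ 0) ∧
        ∀ k, verdict eC eD f g y k ≠ 0 → verdict eC eD f g y k = v := by
  classical
  set va := acceptor f g (fun _ => 0) n with hva
  set vb := acceptor f g (delayed 0) n with hvb
  have hverdict : ∀ y, y 0 = n → ∀ k, verdict eC eD f g y k =
      if firstNonzero (fun t => if eC t n = false ∨ eD k n = true then va t else 0) k = 0 then
        if eC k n = true ∧ ∃ i < k, i % 2 = 1 ∧ y i ≠ 0 then firstNonzero vb k else 0
      else firstNonzero (fun t => if eC t n = false ∨ eD k n = true then va t else 0) k := by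
    intro y hy k
    unfold verdict
    rw [hy]
  have hnotD : n ∈ C \ D → ∀ k, ¬ eD k n = true := fun h k hk => h.2 ((hD.mem_iff n).2 ⟨k, hk⟩)
  by_cases hearly : ∃ t, va t ≠ 0 ∧ eC t n = false
  · -- the decision is made before `n` is enumerated into `C`
    obtain ⟨ht, htC⟩ := Nat.find_spec hearly
    set t := Nat.find hearly with ht_def
    have hmin : ∀ s < t, va s = 0 := by
      intro s hs
      by_contra h
      refine Nat.find_min hearly hs ⟨h, ?_⟩
      by_contra h'
      have := hC.mono hs.le (Bool.eq_true_of_not_eq_false h')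
      rw [htC] at this
      exact Bool.false_ne_true this
    have hfirst : ∀ k, t < k → firstNonzero
        (fun t => if eC t n = false ∨ eD k n = true then va t else 0) k = va t := by
      intro k hk
      refine (firstNonzero_eq ht).2 ⟨t, hk, by simp [htC], fun s hs => by simp [hmin s hs]⟩
    refine ⟨va t, Or.inl ⟨t, rfl⟩, ht, fun y hy _ => ⟨⟨t + 1, ?_⟩, fun k hk => ?_⟩⟩
    · rw [hverdict y hy, hfirst _ (Nat.lt_succ_self t), if_neg ht]
      exact ht
    · rw [hverdict y hy] at hk ⊢
      by_cases htk : t < k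
      · rw [hfirst k htk, if_neg ht]
      · have h1 : firstNonzero
            (fun t => if eC t n = false ∨ eD k n = true then va t else 0) k = 0 :=
          firstNonzero_eq_zero.2 fun s hs => by simp [hmin s (by omega)]
        -- Up to stage `t` the element `n` is not yet in `C`, so a nonzero symbol in the name cannot
        -- trigger the second branch too early.
        have h2 : ¬ eC k n = true := fun h => by
          have := hC.mono (not_lt.1 htk) h
          rw [htC] at this
          exact Bool.false_ne_true this
        rw [if_pos h1, if_neg fun h => h2 h.1] at hk
        exact absurd rfl hk
  · push Not at hearly
    by_cases hn : n ∈ C \ D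
    · obtain ⟨t, ht⟩ := h1 hn
      have hzero : ∀ k, firstNonzero
          (fun t => if eC t n = false ∨ eD k n = true then va t else 0) k = 0 := by
        intro k
        refine firstNonzero_eq_zero.2 fun s _ => ?_
        by_cases hs : va s = 0
        · simp [hs]
        · exact if_neg fun h => h.elim (hearly s hs) (hnotD hn k)
      have ht' : firstNonzero vb (t + 1) ≠ 0 :=
        fun h => ht (firstNonzero_eq_zero.1 h t (Nat.lt_succ_self t))
      obtain ⟨s, -, hs, -⟩ := (firstNonzero_eq ht').1 rfl
      refine ⟨firstNonzero vb (t + 1), Or.inr ⟨hn, s, hs⟩, ht', fun y hy hyA => ⟨?_, fun k hk => ?_⟩⟩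
      · obtain ⟨i, hi⟩ := hyA.1 hn
        obtain ⟨r, hr⟩ := (hC.mem_iff n).1 hn.1
        refine ⟨max (t + 1) (max (2 * i + 2) r), ?_⟩
        rw [hverdict y hy, if_pos (hzero _), if_pos ⟨hC.mono (by omega) hr, 2 * i + 1, by omega,
          by omega, hi⟩, firstNonzero_mono (by omega) ht']
        exact ht'
      · rw [hverdict y hy, if_pos (hzero k)] at hk ⊢
        split_ifs at hk ⊢ with h
        · exact firstNonzero_unique hk ht'
        · exact absurd rfl hk
    · obtain ⟨t, ht⟩ := h0 hn
      have ht' : firstNonzero va (t + 1) ≠ 0 :=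
        fun h => ht (firstNonzero_eq_zero.1 h t (Nat.lt_succ_self t))
      obtain ⟨s, -, hs, -⟩ := (firstNonzero_eq ht').1 rfl
      -- Here `⟨n, 0^ω⟩` is a true name, so an answer appears on it; as it was not early, `n` is
      -- already in `C`, and `n ∉ A` then forces `n ∈ D`.
      have hnC : n ∈ C := (hC.mem_iff n).2 ⟨t, Bool.eq_true_of_not_eq_false (hearly t ht)⟩
      have hnD : n ∈ D := by
        by_contra h
        exact hn ⟨hnC, h⟩
      obtain ⟨r, hr⟩ := (hD.mem_iff n).1 hnD
      have hknown : ∀ k, eD k n = true → firstNonzero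
          (fun t => if eC t n = false ∨ eD k n = true then va t else 0) k = firstNonzero va k :=
        fun k hk => firstNonzero_congr fun i _ => if_pos (Or.inr hk)
      refine ⟨firstNonzero va (t + 1), Or.inl ⟨s, hs⟩, ht', fun y hy hyA => ⟨?_, fun k hk => ?_⟩⟩
      · refine ⟨max (t + 1) r, ?_⟩
        have hr' := hD.mono (le_max_right (t + 1) r) hr
        have hfirst := firstNonzero_mono (le_max_left (t + 1) r) ht'
        rw [hverdict y hy, hknown _ hr', hfirst, if_neg ht']
        exact ht'
      · rw [hverdict y hy] at hk ⊢
        have hno : ¬ ∃ i < k, i % 2 = 1 ∧ y i ≠ 0 := by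
          rintro ⟨i, -, h2, h3⟩
          exact hn (hyA.2 ⟨i / 2, by rwa [show 2 * (i / 2) + 1 = i by omega]⟩)
        rw [if_neg (show ¬ (eC k n = true ∧ _) from fun h => hno h.2)] at hk ⊢
        by_cases hk' : eD k n = true
        · rw [hknown k hk'] at hk ⊢
          split_ifs at hk ⊢ with h
          · exact absurd rfl hk
          · exact firstNonzero_unique h ht'
        · have hzero : firstNonzero
              (fun t => if eC t n = false ∨ eD k n = true then va t else 0) k = 0 := by
            refine firstNonzero_eq_zero.2 fun s _ => ?_
            by_cases hs : va s = 0
            · simp [hs]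
            · exact if_neg fun h => h.elim (hearly s hs) hk'
          rw [if_pos hzero] at hk
          exact absurd rfl hk

theorem acceptor_eq_one {f g b : ℕ → ℕ} {n t : ℕ} :
    acceptor f g b n t = 1 ↔ Accepts g (pointSeq n b) t := by
  unfold acceptor
  split_ifs with h h' <;> simp [h]

theorem acceptor_ne_zero {f g b : ℕ → ℕ} {n t : ℕ} :
    acceptor f g b n t ≠ 0 ↔ Accepts g (pointSeq n b) t ∨ Accepts f (pointSeq n b) t := by
  unfold acceptor
  split_ifs with h h' <;> simp [*]

/-- The codes `f` and `g` describe the complements of `F` and `G`. Acceptance by `g` allows the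
point to go to `U`, acceptance by `f` to go to `V`; by disjointness at least one of them accepts. -/
theorem isComputablyNormal_of_isTwoCE {A : Set ℕ} (hA : IsTwoCE A) :
    IsComputablyNormal (spaceS A) := by
  classical
  have hdom : (normMap (spaceS A)).dom = {P | Disjoint P.1.1 P.2.1} := by
    ext ⟨F, G⟩
    constructor
    · rintro ⟨⟨U, V⟩, hUV, hF, hG⟩
      exact hUV.mono hF hG
    · intro h
      exact ⟨(⟨F.1, isOpenSet_spaceS _⟩, ⟨G.1, isOpenSet_spaceS _⟩), h, subset_rfl, subset_rfl⟩
  refine ⟨hdom, ?_⟩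
  obtain ⟨C, D, hC, hD, rfl⟩ := hA
  obtain ⟨eC, hC⟩ := exists_isEnumeration hC
  obtain ⟨eD, hD⟩ := exists_isEnumeration hD
  obtain ⟨cU, hU⟩ := exists_code_verdict hC.primrec hD.primrec 1
  obtain ⟨cV, hV⟩ := exists_code_verdict hC.primrec hD.primrec 2
  obtain ⟨c, hc⟩ := exists_code_consSeq (Encodable.encode cU) (Encodable.encode cV)
  refine ⟨c, fun p ⟨F, G⟩ hp hFG => ?_⟩
  rw [hdom] at hFG
  replace hFG : Disjoint F.1 G.1 := hFG
  obtain ⟨hF, hG⟩ := hp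
  set f := fun i => p (2 * i) with hf
  set g := fun i => p (2 * i + 1) with hg
  have hmemF : ∀ y n, (spaceS (C \ D)).names y (pointS _ n) →
      (pointS _ n ∉ F.1 ↔ ∃ s, Accepts f y s) := fun y n hy => mem_iff_accepts hF hy
  have hmemG : ∀ y n, (spaceS (C \ D)).names y (pointS _ n) →
      (pointS _ n ∉ G.1 ↔ ∃ s, Accepts g y s) := fun y n hy => mem_iff_accepts hG hy
  have hsome : ∀ n b, (spaceS (C \ D)).names (pointSeq n b) (pointS _ n) →
      ∃ t, acceptor f g b n t ≠ 0 := by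
    intro n b hb
    by_cases h : pointS (C \ D) n ∈ G.1
    · obtain ⟨t, ht⟩ := (hmemF _ n hb).1 fun h' => Set.disjoint_left.1 hFG h' h
      exact ⟨t, acceptor_ne_zero.2 (Or.inr ht)⟩
    · obtain ⟨t, ht⟩ := (hmemG _ n hb).1 h
      exact ⟨t, acceptor_ne_zero.2 (Or.inl ht)⟩
  -- Any finite run on `⟨n, 0^ω⟩` is also a run on a true name of the point over `n`, whichever its
  -- truth value, so answers found there can be trusted.
  have hname : ∀ n t, ∃ b, (spaceS (C \ D)).names (pointSeq n b) (pointS _ n) ∧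
      ∀ i < t, pointSeq n (fun _ => 0) i = pointSeq n b i := by
    intro n t
    by_cases hn : n ∈ C \ D
    · exact ⟨delayed t, names_pointSeq_delayed hn t, fun _ => pointSeq_delayed_congr n⟩
    · exact ⟨fun _ => 0, names_pointSeq_zero hn, fun _ _ => rfl⟩
  choose v hv hv0 hvy using fun n => exists_verdict hC hD (f := f) (g := g) (n := n)
    (fun hn => hsome n _ (names_pointSeq_zero hn))
    (fun hn => hsome n _ (names_pointSeq_delayed hn 0))
  have hacc : ∀ n, ∃ b t, (spaceS (C \ D)).names (pointSeq n b) (pointS _ n) ∧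
      acceptor f g b n t = v n := by
    intro n
    rcases hv n with ⟨t, ht⟩ | ⟨hn, t, ht⟩
    · obtain ⟨b, hb, hb'⟩ := hname n t
      exact ⟨b, t, hb, by rw [← ht, acceptor_congr (fun _ _ => rfl) (fun _ _ => rfl) hb']⟩
    · exact ⟨delayed 0, t, names_pointSeq_delayed hn 0, ht⟩
  have hopen : ∀ w (cw : Code), w ≠ 0 → (∀ p y, Computes cw (interleave p y) fun k =>
      if verdict eC eD (fun i => p (2 * i)) (fun i => p (2 * i + 1)) y k = w then 1 else 0) →
      (spaceS (C \ D)).opens.names (consSeq (Encodable.encode cw) p)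
        ⟨{x | v x.1.1 = w}, isOpenSet_spaceS _⟩ := by
    intro w cw hw hcw y x hy
    refine ⟨_, codedComputes_consSeq (hcw p y), ?_⟩
    change (v x.1.1 = w) = ∃ k, (if verdict eC eD f g y k = w then 1 else 0) ≠ 0
    obtain ⟨hy0, hyA⟩ := names_spaceS.1 hy
    obtain ⟨⟨k, hk⟩, huniq⟩ := hvy x.1.1 y hy0 hyA
    refine propext ⟨fun h => ⟨k, ?_⟩, ?_⟩
    · rw [if_pos ((huniq k hk).trans h)]
      exact one_ne_zero
    · rintro ⟨k, hk⟩
      by_cases h : verdict eC eD f g y k = w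
      · rw [← h, huniq k (by rwa [h])]
      · exact absurd (if_neg h) hk
  refine ⟨_, hc p, (⟨{x | v x.1.1 = 1}, isOpenSet_spaceS _⟩,
    ⟨{x | v x.1.1 = 2}, isOpenSet_spaceS _⟩), ⟨?_, ?_, ?_⟩, ?_, ?_⟩
  · rw [Set.disjoint_left]
    intro x (h1 : v x.1.1 = 1) (h2 : v x.1.1 = 2)
    omega
  · intro x hx
    obtain ⟨b, t, hb, ht⟩ := hacc x.1.1
    rcases acceptor_ne_zero.1 (ht.trans_ne (hv0 x.1.1)) with h | h
    · exact ht.symm.trans (acceptor_eq_one.2 h)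
    · exact absurd (eq_pointS x ▸ hx) ((hmemF _ _ hb).2 ⟨t, h⟩)
  · intro x hx
    obtain ⟨b, t, hb, ht⟩ := hacc x.1.1
    have hng : ¬ Accepts g (pointSeq x.1.1 b) t := fun h =>
      absurd (eq_pointS x ▸ hx) ((hmemG _ _ hb).2 ⟨t, h⟩)
    rcases acceptor_ne_zero.1 (ht.trans_ne (hv0 x.1.1)) with h | h
    · exact absurd h hng
    · refine ht.symm.trans ?_
      simp [acceptor, hng, h]
  · simpa only [interleave_even] using hopen 1 cU one_ne_zero hU
  · simpa only [interleave_odd] using hopen 2 cV two_ne_zero hV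

end TypeTwo

theorem proposition23 (A : Set ℕ) :
    List.TFAE [TypeTwo.ComputablyEmbeds (TypeTwo.spaceS A) TypeTwo.hilbertCube,
      TypeTwo.IsComputablyNormal (TypeTwo.spaceS A),
      TypeTwo.IsTwoCE A] := by
  tfae_have 1 → 3 := TypeTwo.isTwoCE_of_computablyEmbeds
  tfae_have 3 → 1 := TypeTwo.computablyEmbeds_of_isTwoCE
  tfae_have 2 → 3 := TypeTwo.isTwoCE_of_isComputablyNormal
  tfae_have 3 → 2 := TypeTwo.isComputablyNormal_of_isTwoCE
  tfae_finish
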